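/- Let $\mathsf B$ be a category and $\mathcal F$ a class of arrows of $\mathsf B$ (display maps) such that pullbacks of arrows of $\mathcal F$ along arbitrary arrows exist and lie in $\mathcal F$, all isomorphisms lie in $\mathcal F$, and $\mathcal F$ is closed under composition. Let $p:\mathsf E\to\mathsf B$ be a Grothendieck fibration with $\mathcal F$-coproducts: for each $v\in\mathcal F$ the reindexing functor $v^*$ between fibres has a left adjoint $\coprod_v$, and for each pullback square $fu=vg$ with $u,v\in\mathcal F$ the Beck--Chevalley map $\coprod_u g^*\to f^*\coprod_v$ is an isomorphism. For a fibration $q:\mathsf D\to\mathsf B$, the $\mathcal F$-coproduct completion $\Sigma_{\mathcal F}(q):\Sigma_{\mathcal F}(\mathsf D)\to\mathsf B$ has as objects the pairs $(g:X\to I,\alpha)$ with $g\in\mathcal F$ and $\alpha\in\mathsf D_X$, as arrows $(g:X\to I,\alpha)\to(h:Y\to J,\beta)$ the triples $(f_0:I\to J,\ f_1:X\to Y,\ \varphi:\alpha\to\beta)$ with $hf_1=f_0g$ and $q(\varphi)=f_1$, and it sends $(g:X\to I,\alpha)$ to $I$ and $(f_0,f_1,\varphi)$ to $f_0$. The unit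 $q\to\Sigma_{\mathcal F}(q)$ sends $\alpha\in\mathsf D_X$ to $(\mathrm{id}_X,\alpha)$. An object $\alpha\in\mathsf E_A$ is $(\mathcal F,\coprod)$-quantifier splitting if for all $u:B\to A$ in $\mathcal F$, $\beta\in\mathsf E_B$ and vertical $h:\alpha\to\coprod_u\beta$ there is a unique pair of a section $g$ of $u$ and a vertical $\overline h:\alpha\to g^*\beta$ with $h=g^*(\eta_\beta)\circ\overline h$, where $\eta$ is the unit of $\coprod_u\dashv u^*$ and $g^*u^*\coprod_u\beta$ is identified with $\coprod_u\beta$ by the canonical isomorphism. It is $(\mathcal F,\coprod)$-quantifier-free if $f^*\alpha$ is quantifier splitting for every $f:I\to A$ in $\mathsf B$. The fibration $p$ has enough $(\mathcal F,\coprod)$-quantifier-free objects if for all $I\in\mathsf B$ and $\alpha\in\mathsf E_I$ there are $f:A\to I$ in $\mathcal F$ and a quantifier-free $\beta\in\mathsf E_A$ with $\alpha\cong\coprod_f\beta$ in $\mathsf E_I$. **Theorem.** There is a fibration $q$ over $\mathsf B$ with $\Sigma_{\mathcal F}(q)$ equivalent to $p$ as a fibration over $\mathsf B$ if and only if $p$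 has enough $(\mathcal F,\coprod)$-quantifier-free objects. Moreover, the full subcategory of $\mathsf E$ on the quantifier-free objects is a subfibration $\overline p$ of $p$. There is a functor $\Sigma_{\mathcal F}(\overline p)\to p$ over $\mathsf B$, unique up to vertical natural isomorphism, that preserves cartesian arrows and $\mathcal F$-coproducts and whose restriction along the unit $\overline p\to\Sigma_{\mathcal F}(\overline p)$ is vertically isomorphic to the inclusion $\overline p\to p$. This comparison functor is an equivalence of fibrations over $\mathsf B$ if and only if $p$ has enough $(\mathcal F,\coprod)$-quantifier-free objects. -/

import Mathlib

open CategoryTheory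

universe v₁ v₂ v₃ u₁ u₂ u₃

noncomputable section

namespace FibCoprod

open Functor.IsPreFibered

/-! ### Display maps -/

/-- A class `F` of display maps: pullbacks of arrows of `F` along arbitrary arrows exist and belong
to `F`. -/
structure IsDisplayMapClass {B : Type u₁} [Category.{v₁} B] (F : MorphismProperty B) : Prop where
  hasPullback : ∀ {K I J : B} (f : I ⟶ J) (v : K ⟶ J), F v → Limits.HasPullback f v
  of_isPullback : ∀ {P K I J : B} {g : P ⟶ K} {u : P ⟶ I} {v : K ⟶ J} {f : I ⟶ J},
    IsPullback g u v f → F v → F u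

/-- The display map category has units: all isomorphisms are display maps. -/
def HasUnits {B : Type u₁} [Category.{v₁} B] (F : MorphismProperty B) : Prop :=
  MorphismProperty.isomorphisms B ≤ F

/-- The display map category has dependent coproducts: display maps are closed under
composition. -/
def HasDependentCoproducts {B : Type u₁} [Category.{v₁} B] (F : MorphismProperty B) : Prop :=
  ∀ {I J K : B} (f : I ⟶ J) (g : J ⟶ K), F f → F g → F (f ≫ g)

/-! ### Reindexing in a fibration -/

section Reindexing

variable {B : Type u₁} [Category.{v₁} B] {E : Type u₂} [Category.{v₂} E]
variable (p : E ⥤ B) [p.IsFibered]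

/-- The object `u^* X` of the fibre over `L`, for the cleavage chosen once and for all. -/
def reindexObj {L J : B} (u : L ⟶ J) (X : p.Fiber J) : p.Fiber L :=
  ⟨pullbackObj X.2 u, pullbackObj_proj X.2 u⟩

/-- The chosen cartesian lifting `u^* X ⟶ X` of `u`. -/
def lift {L J : B} (u : L ⟶ J) (X : p.Fiber J) : (reindexObj p u X).1 ⟶ X.1 :=
  pullbackMap X.2 u

instance lift_isCartesian {L J : B} (u : L ⟶ J) (X : p.Fiber J) :
    p.IsCartesian u (lift p u X) :=
  pullbackMap.IsCartesian X.2 u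

/-- The composite `u^* (v^* X) ⟶ v^* X ⟶ X` of chosen cartesian liftings. -/
def liftLift {K L J : B} (u : K ⟶ L) (v : L ⟶ J) (X : p.Fiber J) :
    (reindexObj p u (reindexObj p v X)).1 ⟶ X.1 :=
  lift p u (reindexObj p v X) ≫ lift p v X

instance liftLift_isHomLift {K L J : B} (u : K ⟶ L) (v : L ⟶ J) (X : p.Fiber J) :
    p.IsHomLift (u ≫ v) (liftLift p u v X) :=
  inferInstanceAs (p.IsHomLift (u ≫ v) (lift p u (reindexObj p v X) ≫ lift p v X))

/-- The composite `u^* X ⟶ X ⟶ Y` of the cartesian lifting with a vertical arrow. -/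
def liftThen {L J : B} (u : L ⟶ J) {X Y : p.Fiber J} (φ : X ⟶ Y) :
    (reindexObj p u X).1 ⟶ Y.1 :=
  lift p u X ≫ φ.1

instance liftThen_isHomLift {L J : B} (u : L ⟶ J) {X Y : p.Fiber J} (φ : X ⟶ Y) :
    p.IsHomLift u (liftThen p u φ) :=
  haveI : p.IsHomLift (𝟙 J) φ.1 := φ.2
  inferInstanceAs (p.IsHomLift u (lift p u X ≫ φ.1))

/-- The vertical arrow `u^* φ : u^* X ⟶ u^* Y`: the unique one with
`u^* φ ≫ (u^* Y ⟶ Y) = (u^* X ⟶ X) ≫ φ`. -/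
def reindexMap {L J : B} (u : L ⟶ J) {X Y : p.Fiber J} (φ : X ⟶ Y) :
    reindexObj p u X ⟶ reindexObj p u Y :=
  ⟨Functor.IsCartesian.map p u (lift p u Y) (liftThen p u φ), inferInstance⟩

lemma reindexMap_fac {L J : B} (u : L ⟶ J) {X Y : p.Fiber J} (φ : X ⟶ Y) :
    (reindexMap p u φ).1 ≫ lift p u Y = lift p u X ≫ φ.1 :=
  Functor.IsCartesian.fac p u (lift p u Y) (liftThen p u φ)

lemma reindexMap_uniq {L J : B} (u : L ⟶ J) {X Y : p.Fiber J} (φ : X ⟶ Y)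
    (ψ : reindexObj p u X ⟶ reindexObj p u Y) (h : ψ.1 ≫ lift p u Y = lift p u X ≫ φ.1) :
    reindexMap p u φ = ψ := by
  have : p.IsHomLift (𝟙 L) ψ.1 := ψ.2
  exact Subtype.ext
    (Functor.IsCartesian.map_uniq p u (lift p u Y) (liftThen p u φ) ψ.1 h).symm

/-- The reindexing (substitution) functor `u^*` between fibres. -/
def reindex {L J : B} (u : L ⟶ J) : p.Fiber J ⥤ p.Fiber L where
  obj X := reindexObj p u X
  map φ := reindexMap p u φ
  map_id X := by
    apply reindexMap_uniq
    change 𝟙 _ ≫ _ = _ ≫ 𝟙 _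
    rw [Category.id_comp, Category.comp_id]
  map_comp {X Y Z} φ ψ := by
    apply reindexMap_uniq
    change ((reindexMap p u φ).1 ≫ (reindexMap p u ψ).1) ≫ _ = _ ≫ (φ.1 ≫ ψ.1)
    rw [Category.assoc, reindexMap_fac, ← Category.assoc, reindexMap_fac, Category.assoc]

/-- For a section `g` of `u`, the canonical vertical isomorphism `g^* u^* X ⟶ X`: the composite of
the cartesian liftings `g^* u^* X ⟶ u^* X ⟶ X`, which lies over `g ≫ u = 𝟙 A`. -/
def sectionHom {L A : B} (u : L ⟶ A) (g : A ⟶ L) (hg : g ≫ u = 𝟙 A) (X : p.Fiber A) :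
    (reindex p g).obj ((reindex p u).obj X) ⟶ X :=
  ⟨liftLift p g u X, hg ▸ liftLift_isHomLift p g u X⟩

/-- For a commutative square `u ≫ f = g ≫ v`, the unique arrow `g^* v^* X ⟶ f^* X` over `u`
compatible with the liftings to `X`. -/
def exchangeAux {K I L J : B} {u : K ⟶ I} {f : I ⟶ J} {g : K ⟶ L} {v : L ⟶ J}
    (w : u ≫ f = g ≫ v) (X : p.Fiber J) :
    (reindexObj p g (reindexObj p v X)).1 ⟶ (reindexObj p f X).1 :=
  Functor.IsStronglyCartesian.map p f (lift p f X) w.symm (liftLift p g v X)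

instance exchangeAux_isHomLift {K I L J : B} {u : K ⟶ I} {f : I ⟶ J} {g : K ⟶ L} {v : L ⟶ J}
    (w : u ≫ f = g ≫ v) (X : p.Fiber J) : p.IsHomLift u (exchangeAux p w X) :=
  Functor.IsStronglyCartesian.map_isHomLift p f (lift p f X) w.symm (liftLift p g v X)

/-- For a commutative square `u ≫ f = g ≫ v`, the unique vertical arrow `g^* v^* X ⟶ u^* f^* X`
compatible with the liftings to `X`. -/
def exchange {K I L J : B} {u : K ⟶ I} {f : I ⟶ J} {g : K ⟶ L} {v : L ⟶ J}
    (w : u ≫ f = g ≫ v) (X : p.Fiber J) :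
    reindexObj p g (reindexObj p v X) ⟶ reindexObj p u (reindexObj p f X) :=
  ⟨Functor.IsCartesian.map p u (lift p u (reindexObj p f X)) (exchangeAux p w X), inferInstance⟩

/-- `exchange` as an arrow between values of the reindexing functors; it is an isomorphism. -/
def exchangeHom {K I L J : B} {u : K ⟶ I} {f : I ⟶ J} {g : K ⟶ L} {v : L ⟶ J}
    (w : u ≫ f = g ≫ v) (X : p.Fiber J) :
    (reindex p g).obj ((reindex p v).obj X) ⟶ (reindex p u).obj ((reindex p f).obj X) :=
  exchange p w X

/-! ### Coproducts along display maps -/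

/-- The left adjoint `∐_v` of `v^*`. -/
abbrev coprod {L J : B} (v : L ⟶ J) [(reindex p v).IsRightAdjoint] : p.Fiber L ⥤ p.Fiber J :=
  (reindex p v).leftAdjoint

/-- The adjunction `∐_v ⊣ v^*`. -/
abbrev coprodAdj {L J : B} (v : L ⟶ J) [(reindex p v).IsRightAdjoint] :
    coprod p v ⊣ reindex p v :=
  Adjunction.ofIsRightAdjoint (reindex p v)

/-- The Beck-Chevalley arrow `∐_u g^* β ⟶ f^* ∐_v β` at `β`: the transpose of
`g^* β ⟶ g^* v^* ∐_v β ≅ u^* f^* ∐_v β`, whose first arrow is `g^*` of the unit. -/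
def beckChevalley {K I L J : B} {u : K ⟶ I} {f : I ⟶ J} {g : K ⟶ L} {v : L ⟶ J}
    (w : u ≫ f = g ≫ v) [(reindex p u).IsRightAdjoint] [(reindex p v).IsRightAdjoint]
    (β : p.Fiber L) :
    (coprod p u).obj ((reindex p g).obj β) ⟶ (reindex p f).obj ((coprod p v).obj β) :=
  ((coprodAdj p u).homEquiv _ _).symm
    ((reindex p g).map ((coprodAdj p v).unit.app β) ≫ exchangeHom p w ((coprod p v).obj β))

/-- The fibration `p` has (fibred) `F`-coproducts: reindexing along display maps has left adjoints,
and these satisfy the Beck-Chevalley condition. -/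
class HasCoproducts (F : MorphismProperty B) : Prop where
  isRightAdjoint : ∀ {L J : B} (v : L ⟶ J), F v → (reindex p v).IsRightAdjoint
  isIso_beckChevalley : ∀ {K I L J : B} {u : K ⟶ I} {f : I ⟶ J} {g : K ⟶ L} {v : L ⟶ J}
    (sq : IsPullback u g f v) (hu : F u) (hv : F v) (β : p.Fiber L),
    haveI := isRightAdjoint u hu
    haveI := isRightAdjoint v hv
    IsIso (beckChevalley p sq.w β)

/-! ### Quantifier-free objects -/

variable (F : MorphismProperty B) [HasCoproducts p F]

/-- `α` over `A` is `(F, ∐)`-quantifier splitting: every vertical `h : α ⟶ ∐_u β`, with `u : L ⟶ A`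
in `F`, determines a unique pair of a section `g` of `u` and a vertical `k : α ⟶ g^* β` with
`h = g^* η_β ∘ k`, modulo the canonical `g^* u^* ∐_u β ≅ ∐_u β`. -/
def IsQuantifierSplitting {A : B} (α : p.Fiber A) : Prop :=
  ∀ {L : B} (u : L ⟶ A) (hu : F u) (β : p.Fiber L),
    haveI : (reindex p u).IsRightAdjoint := HasCoproducts.isRightAdjoint u hu
    ∀ h : α ⟶ (coprod p u).obj β,
      ∃! s : (g : {g : A ⟶ L // g ≫ u = 𝟙 A}) × (α ⟶ (reindex p g.1).obj β),
        h = s.2 ≫ (reindex p s.1.1).map ((coprodAdj p u).unit.app β) ≫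
          sectionHom p u s.1.1 s.1.2 ((coprod p u).obj β)

/-- `α` over `A` is `(F, ∐)`-quantifier-free: all its reindexings are quantifier splitting. -/
def IsQuantifierFree {A : B} (α : p.Fiber A) : Prop :=
  ∀ {I : B} (f : I ⟶ A), IsQuantifierSplitting p F ((reindex p f).obj α)

/-- `p` has enough `(F, ∐)`-quantifier-free objects: every `α` over `I` is vertically isomorphic to
`∐_f β` for some `f : A ⟶ I` in `F` and some quantifier-free `β` over `A`. -/
def EnoughQuantifierFree : Prop :=
  ∀ {I : B} (α : p.Fiber I), ∃ (A : B) (f : A ⟶ I) (hf : F f) (β : p.Fiber A),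
    haveI : (reindex p f).IsRightAdjoint := HasCoproducts.isRightAdjoint f hf
    IsQuantifierFree p F β ∧ Nonempty (α ≅ (coprod p f).obj β)

/-- The property of objects of the total category of being quantifier-free in their fibre. -/
def quantifierFree : ObjectProperty E :=
  fun X => IsQuantifierFree p F (⟨X, rfl⟩ : p.Fiber (p.obj X))

/-- The full subfibration of `p` on the quantifier-free objects. -/
def qfProj : (quantifierFree p F).FullSubcategory ⥤ B :=
  (quantifierFree p F).ι ⋙ p

/-- The inclusion of the quantifier-free objects, as a functor over `B`. -/
def qfIncl : BasedCategory.ofFunctor (qfProj p F) ⥤ᵇ BasedCategory.ofFunctor p where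
  toFunctor := (quantifierFree p F).ι
  w := rfl

end Reindexing

/-! ### The coproduct completion -/

section Completion

variable {B : Type u₁} [Category.{v₁} B] {E : Type u₂} [Category.{v₂} E]

/-- Objects `(g : X ⟶ I, α)` of the completion `Σ_F(E)`, with `g` in `F` and `α` in the fibre over
`X`; thus `X` is `q.obj α` and need not be recorded. -/
structure Completion (F : MorphismProperty B) (q : E ⥤ B) where
  /-- The object `α`, in the fibre over the domain of the display map. -/
  obj : E
  /-- The codomain `I` of the display map. -/
  base : B
  /-- The display map `g`. -/
  disp : q.obj obj ⟶ base
  mem : F disp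

variable {F : MorphismProperty B} {q : E ⥤ B}

/-- Morphisms `(f₀, f₁, φ) : (g : X ⟶ I, α) ⟶ (h : Y ⟶ J, β)` of the completion: a commutative
square `(f₁, f₀)` from `g` to `h` and an arrow `φ : α ⟶ β` over `f₁`; thus `f₁` is `q.map φ` and
need not be recorded. -/
@[ext]
structure Completion.Hom (x y : Completion F q) where
  /-- The arrow `f₀` of the base. -/
  base : x.base ⟶ y.base
  /-- The arrow `φ` of the total category. -/
  hom : x.obj ⟶ y.obj
  w : q.map hom ≫ y.disp = x.disp ≫ base

instance : Category (Completion F q) where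
  Hom := Completion.Hom
  id x := ⟨𝟙 _, 𝟙 _, by simp⟩
  comp {x y z} a b := ⟨a.base ≫ b.base, a.hom ≫ b.hom, by
    rw [q.map_comp, Category.assoc, b.w, ← Category.assoc, a.w, Category.assoc]⟩
  id_comp a := by apply Completion.Hom.ext <;> simp
  comp_id a := by apply Completion.Hom.ext <;> simp
  assoc a b c := by apply Completion.Hom.ext <;> simp

variable (F q)

/-- The functor `Σ_F(q) : Σ_F(E) ⥤ B`, `(g : X ⟶ I, α) ↦ I`. -/
def completionProj : Completion F q ⥤ B where
  obj x := x.base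
  map a := a.base

/-- The unit `q ⟶ Σ_F(q)`, `α ↦ (𝟙 : X ⟶ X, α)` for `α` over `X`. -/
def completionUnit (hF : HasUnits F) :
    BasedCategory.ofFunctor q ⥤ᵇ BasedCategory.ofFunctor (completionProj F q) where
  toFunctor :=
    { obj := fun α => (⟨α, q.obj α, 𝟙 _, hF _ (.infer_property _)⟩ : Completion F q)
      map := fun {α β} φ => (⟨q.map φ, φ, by simp⟩ : Completion.Hom _ _)
      map_id := fun α => by
        apply Completion.Hom.ext
        · exact q.map_id α
        · rfl
      map_comp := fun φ ψ => by
        apply Completion.Hom.ext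
        · exact q.map_comp φ ψ
        · rfl }
  w := rfl

end Completion

/-! ### Functors and equivalences of fibrations over `B` -/

section Functors

variable {B : Type u₁} [Category.{v₁} B]

/-- A functor over `B` is fibred if it preserves cartesian arrows. -/
def IsFibredFunctor {X : BasedCategory.{v₂, u₂} B} {Y : BasedCategory.{v₃, u₃} B}
    (G : X ⥤ᵇ Y) : Prop :=
  ∀ {R S : B} (f : R ⟶ S) {a b : X.obj} (φ : a ⟶ b),
    X.p.IsStronglyCartesian f φ → Y.p.IsStronglyCartesian f (G.map φ)

/-- A functor over `B` preserves `F`-coproducts if it preserves cocartesian arrows over display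
maps. (The cocartesian arrow over `u` out of `β` is `β ⟶ u^* ∐_u β ⟶ ∐_u β`.) -/
def PreservesCoproducts (F : MorphismProperty B)
    {X : BasedCategory.{v₂, u₂} B} {Y : BasedCategory.{v₃, u₃} B} (G : X ⥤ᵇ Y) : Prop :=
  ∀ {R S : B} (f : R ⟶ S), F f → ∀ {a b : X.obj} (φ : a ⟶ b),
    X.p.IsStronglyCocartesian f φ → Y.p.IsStronglyCocartesian f (G.map φ)

/-- `G` is an equivalence of fibrations over `B`: it is fibred, and has a fibred quasi-inverse
over `B`, up to vertical natural isomorphisms. -/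
def IsFibredEquivalence {X : BasedCategory.{v₂, u₂} B} {Y : BasedCategory.{v₃, u₃} B}
    (G : X ⥤ᵇ Y) : Prop :=
  IsFibredFunctor G ∧ ∃ H : Y ⥤ᵇ X, IsFibredFunctor H ∧
    Nonempty (BasedFunctor.comp G H ≅ BasedFunctor.id X) ∧
    Nonempty (BasedFunctor.comp H G ≅ BasedFunctor.id Y)

/-- Fibred equivalence of two functors to `B`. -/
def FibredEquivalent {D : Type u₂} [Category.{v₂} D] {E : Type u₃} [Category.{v₃} E]
    (q : D ⥤ B) (p : E ⥤ B) : Prop :=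
  ∃ G : BasedCategory.ofFunctor q ⥤ᵇ BasedCategory.ofFunctor p, IsFibredEquivalence G

/-- `G : Σ_F(p̄) ⟶ p` is the comparison, for the full subfibration `p̄` of quantifier-free objects:
it is fibred, preserves `F`-coproducts, and restricts along the unit `p̄ ⟶ Σ_F(p̄)` to the inclusion
`p̄ ⟶ p`, up to vertical natural isomorphism. -/
structure IsComparison {E : Type u₂} [Category.{v₂} E] (p : E ⥤ B) [p.IsFibered]
    (F : MorphismProperty B) (hF : HasUnits F) [HasCoproducts p F]
    (G : BasedCategory.ofFunctor (completionProj F (qfProj p F)) ⥤ᵇ BasedCategory.ofFunctor p) :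
    Prop where
  fibred : IsFibredFunctor G
  preservesCoproducts : PreservesCoproducts F G
  unit : Nonempty (BasedFunctor.comp (completionUnit F (qfProj p F) hF) G ≅ qfIncl p F)

end Functors

end FibCoprod

end

noncomputable section

namespace FibCoprod

/-! ### Cartesian and cocartesian arrows up to vertical isomorphism -/

section Generic

variable {B : Type u₁} [Category.{v₁} B] {X : Type u₂} [Category.{v₂} X] (r : X ⥤ B)

/-! The proof rests on a reformulation: an object `a` is quantifier-free exactly when `a`, and every
domain of a cartesian arrow into `a`, lifts uniquely against all cocartesian arrows over display
maps (`HasStableUniqueLifts`). A section `g` of `u` together with a vertical arrow into `g^* β` is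
the same thing as one arrow into `β`, so quantifier splitting says this for vertical arrows into a
coproduct. Beck-Chevalley extends it to arbitrary arrows, because a cocartesian arrow over a display
map can be pulled back along the base of the arrow to be lifted (`isQuantifierSplitting_iff`,
`isQuantifierFree_iff`). The new form speaks only of cartesian and cocartesian arrows, so it
transports along equivalences over `B`.

In a completion, cartesian arrows are, up to vertical isomorphism, pullback squares with a cartesian
arrow on top, and cocartesian arrows over display maps have invertible total component. Hence the
objects `(𝟙, α)` have stable unique lifts, and `(g, α)` is the coproduct of `(𝟙, α)` along `g`. Any
fibration equivalent to a completion therefore has enough quantifier-free objects.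

Conversely, a comparison must send `(g, α)` to `∐_g α`. `Extension` records this as a natural family
of cocartesian arrows `α ⟶ G (g, α)`. Existence, uniqueness and preservation of coproducts follow
from the universal property, and preservation of cartesian arrows from Beck-Chevalley. Unique
lifting of quantifier-free objects makes the comparison fully faithful
(`Extension.existsUnique_map_eq`), and having enough of them makes it reach every object up to
vertical isomorphism. Such a functor is an equivalence of fibrations
(`IsVerticalEquivalence.isFibredEquivalence`). -/

lemma exists_isHomLift {R S : B} {a b : X} (φ : a ⟶ b) (ha : r.obj a = R) (hb : r.obj b = S) :
    ∃ f : R ⟶ S, r.IsHomLift f φ := by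
  subst ha hb
  exact ⟨r.map φ, inferInstance⟩

lemma isHomLift_unique {R S : B} {a b : X} {f f' : R ⟶ S} (φ : a ⟶ b) (h : r.IsHomLift f φ)
    (h' : r.IsHomLift f' φ) : f = f' := by
  rw [IsHomLift.fac r f φ, IsHomLift.fac r f' φ]

lemma isStronglyCartesian_iso_comp {R S : B} {a a' b : X} (f : R ⟶ S) (i : a' ⟶ a) [IsIso i]
    (hi : r.IsHomLift (𝟙 R) i) (φ : a ⟶ b) (hφ : r.IsStronglyCartesian f φ) :
    r.IsStronglyCartesian f (i ≫ φ) := by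
  have : r.IsStronglyCartesian (𝟙 R ≫ f) (i ≫ φ) := inferInstance
  rwa [Category.id_comp] at this

lemma isStronglyCartesian_comp_iso {R S : B} {a b b' : X} (f : R ⟶ S) (φ : a ⟶ b)
    (hφ : r.IsStronglyCartesian f φ) (i : b ⟶ b') [IsIso i] (hi : r.IsHomLift (𝟙 S) i) :
    r.IsStronglyCartesian f (φ ≫ i) := by
  have : r.IsStronglyCartesian (f ≫ 𝟙 S) (φ ≫ i) := inferInstance
  rwa [Category.comp_id] at this

lemma isStronglyCocartesian_iso_comp {R S : B} {a a' b : X} (f : R ⟶ S) (i : a' ⟶ a) [IsIso i]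
    (hi : r.IsHomLift (𝟙 R) i) (φ : a ⟶ b) (hφ : r.IsStronglyCocartesian f φ) :
    r.IsStronglyCocartesian f (i ≫ φ) := by
  have : r.IsStronglyCocartesian (𝟙 R ≫ f) (i ≫ φ) := inferInstance
  rwa [Category.id_comp] at this

lemma isStronglyCocartesian_comp_iso {R S : B} {a b b' : X} (f : R ⟶ S) (φ : a ⟶ b)
    (hφ : r.IsStronglyCocartesian f φ) (i : b ⟶ b') [IsIso i] (hi : r.IsHomLift (𝟙 S) i) :
    r.IsStronglyCocartesian f (φ ≫ i) := by
  have : r.IsStronglyCocartesian (f ≫ 𝟙 S) (φ ≫ i) := inferInstance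
  rwa [Category.comp_id] at this

/-- Two cartesian arrows over `f` into `b` differ by a vertical isomorphism. -/
lemma exists_iso_of_cartesian {R S : B} {a a' b : X} (f : R ⟶ S) (φ : a ⟶ b) (φ' : a' ⟶ b)
    (hφ : r.IsStronglyCartesian f φ) (hφ' : r.IsStronglyCartesian f φ') :
    ∃ i : a' ≅ a, r.IsHomLift (𝟙 R) i.hom ∧ i.hom ≫ φ = φ' :=
  ⟨Functor.IsCartesian.domainUniqueUpToIso r f φ φ', inferInstance,
    Functor.IsCartesian.fac r f φ φ'⟩

/-- Two cocartesian arrows over `f` out of `a` differ by a vertical isomorphism. -/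
lemma exists_iso_of_cocartesian {R S : B} {a b b' : X} (f : R ⟶ S) (φ : a ⟶ b) (φ' : a ⟶ b')
    (hφ : r.IsStronglyCocartesian f φ) (hφ' : r.IsStronglyCocartesian f φ') :
    ∃ i : b ≅ b', r.IsHomLift (𝟙 S) i.hom ∧ φ ≫ i.hom = φ' :=
  ⟨Functor.IsCocartesian.codomainUniqueUpToIso r f φ φ',
    Functor.IsCocartesian.map_isHomLift r f φ φ', Functor.IsCocartesian.fac r f φ φ'⟩

/-! ### Unique lifting against cocartesian arrows -/

/-- Every arrow from `a` to the codomain of a cocartesian arrow over a display map factors uniquely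
through that cocartesian arrow. -/
def HasUniqueLifts (F : MorphismProperty B) (a : X) : Prop :=
  ∀ ⦃R S : B⦄ (u : R ⟶ S), F u → ∀ ⦃c d : X⦄ (κ : c ⟶ d), r.IsStronglyCocartesian u κ →
    ∀ h : a ⟶ d, ∃! k : a ⟶ c, k ≫ κ = h

/-- The domains of all cartesian arrows into `a` have unique lifts. -/
def HasStableUniqueLifts (F : MorphismProperty B) (a : X) : Prop :=
  ∀ ⦃R S : B⦄ (f : R ⟶ S) ⦃a' : X⦄ (φ : a' ⟶ a), r.IsStronglyCartesian f φ →
    HasUniqueLifts r F a'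

variable {r} {F : MorphismProperty B}

lemma HasUniqueLifts.of_iso {a a' : X} (ha : HasUniqueLifts r F a) (i : a ≅ a') :
    HasUniqueLifts r F a' := by
  intro R S u hu c d κ hκ h
  obtain ⟨k, hk, hk'⟩ := ha u hu κ hκ (i.hom ≫ h)
  refine ⟨i.inv ≫ k, by simp only [Category.assoc, hk, Iso.inv_hom_id_assoc], fun l hl => ?_⟩
  rw [← hk' (i.hom ≫ l) (by simp only [Category.assoc, hl]), Iso.inv_hom_id_assoc]

lemma HasStableUniqueLifts.hasUniqueLifts {a : X} (ha : HasStableUniqueLifts r F a) :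
    HasUniqueLifts r F a :=
  ha (𝟙 (r.obj a)) (𝟙 a) inferInstance

lemma HasStableUniqueLifts.of_cartesian {a a' : X} (ha : HasStableUniqueLifts r F a) {R S : B}
    (f : R ⟶ S) (φ : a' ⟶ a) (hφ : r.IsStronglyCartesian f φ) :
    HasStableUniqueLifts r F a' := by
  intro R' S' f' a'' ψ hψ
  have h1 := IsHomLift.codomain_eq r f' ψ
  have h2 := IsHomLift.domain_eq r f φ
  obtain rfl : S' = R := h1.symm.trans h2
  exact ha (f' ≫ f) (ψ ≫ φ) inferInstance

end Generic

/-! ### Cocartesian arrows in a fibration with coproducts -/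

section Fibration

variable {B : Type u₁} [Category.{v₁} B] {E : Type u₂} [Category.{v₂} E]
variable (p : E ⥤ B) [p.IsFibered]

/-- The unit `β ⟶ v^* ∐_v β`, as an arrow of the total category. -/
def coprodUnit {L J : B} (v : L ⟶ J) [(reindex p v).IsRightAdjoint] (β : p.Fiber L) :
    β.1 ⟶ (reindexObj p v ((coprod p v).obj β)).1 :=
  ((coprodAdj p v).unit.app β).1

instance coprodUnit_isHomLift {L J : B} (v : L ⟶ J) [(reindex p v).IsRightAdjoint]
    (β : p.Fiber L) : p.IsHomLift (𝟙 L) (coprodUnit p v β) :=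
  ((coprodAdj p v).unit.app β).2

/-- The arrow `β ⟶ v^* ∐_v β ⟶ ∐_v β` over `v`. -/
def coprodArrow {L J : B} (v : L ⟶ J) [(reindex p v).IsRightAdjoint] (β : p.Fiber L) :
    β.1 ⟶ ((coprod p v).obj β).1 :=
  coprodUnit p v β ≫ lift p v ((coprod p v).obj β)

instance coprodArrow_isHomLift {L J : B} (v : L ⟶ J) [(reindex p v).IsRightAdjoint]
    (β : p.Fiber L) : p.IsHomLift v (coprodArrow p v β) :=
  inferInstanceAs (p.IsHomLift v (coprodUnit p v β ≫ lift p v ((coprod p v).obj β)))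

/-- Transposition along `∐_v ⊣ v^*`. -/
def coprodEquiv {L J : B} (v : L ⟶ J) [(reindex p v).IsRightAdjoint] (β : p.Fiber L)
    (X : p.Fiber J) : ((coprod p v).obj β ⟶ X) ≃ (β ⟶ reindexObj p v X) :=
  (coprodAdj p v).homEquiv β X

lemma coprodEquiv_val {L J : B} (v : L ⟶ J) [(reindex p v).IsRightAdjoint] (β : p.Fiber L)
    (X : p.Fiber J) (t : (coprod p v).obj β ⟶ X) :
    (coprodEquiv p v β X t).1 = coprodUnit p v β ≫ (reindexMap p v t).1 :=
  congrArg Subtype.val ((coprodAdj p v).homEquiv_unit (X := β) (Y := X) (f := t))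

lemma coprodEquiv_val_comp_lift {L J : B} (v : L ⟶ J) [(reindex p v).IsRightAdjoint]
    (β : p.Fiber L) (X : p.Fiber J) (t : (coprod p v).obj β ⟶ X) :
    (coprodEquiv p v β X t).1 ≫ lift p v X = coprodArrow p v β ≫ t.1 := by
  rw [coprodEquiv_val, coprodArrow]
  exact (Category.assoc _ _ _).trans ((congrArg _ (reindexMap_fac p v t)).trans
    (Category.assoc _ _ _).symm)

/-- Arrows out of `β` over `v` into `X` correspond to vertical arrows `β ⟶ v^* X` by cartesianness
of the lifting, and these to vertical arrows `∐_v β ⟶ X` by transposition. -/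
lemma coprodArrow_isCocartesian {L J : B} (v : L ⟶ J) [(reindex p v).IsRightAdjoint]
    (β : p.Fiber L) : p.IsCocartesian v (coprodArrow p v β) where
  universal_property {b} φ hφ := by
    obtain rfl := IsHomLift.codomain_eq p v φ
    let X : p.Fiber (p.obj b) := ⟨b, rfl⟩
    obtain ⟨ψ, ⟨hψl, hψ⟩, -⟩ :=
      Functor.IsCartesian.universal_property (p := p) (f := v) (φ := lift p v X) φ
    let Ψ : β ⟶ reindexObj p v X := ⟨ψ, hψl⟩
    refine ⟨((coprodEquiv p v β X).symm Ψ).1, ⟨((coprodEquiv p v β X).symm Ψ).2, ?_⟩, ?_⟩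
    · refine (coprodEquiv_val_comp_lift p v β X _).symm.trans ?_
      rw [Equiv.apply_symm_apply]
      exact hψ
    · rintro t ⟨ht, ht'⟩
      let T : (coprod p v).obj β ⟶ X := ⟨t, ht⟩
      have h1 : p.IsHomLift (𝟙 L) (coprodEquiv p v β X T).1 := (coprodEquiv p v β X T).2
      have h2 : (coprodEquiv p v β X T).1 = ψ :=
        Functor.IsCartesian.ext p v (lift p v X) _ _
          ((coprodEquiv_val_comp_lift p v β X T).trans (ht'.trans hψ.symm))
      have h3 : coprodEquiv p v β X T = Ψ := Subtype.ext h2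
      rw [← h3, Equiv.symm_apply_apply]

/-- Every arrow of the base has a cartesian lifting. -/
lemma exists_isStronglyCartesian {R S : B} (f : R ⟶ S) (b : E) (hb : p.obj b = S) :
    ∃ (a : E) (φ : a ⟶ b), p.IsStronglyCartesian f φ := by
  obtain ⟨a, φ, h⟩ := IsPreFibered.exists_isCartesian p hb f
  exact ⟨a, φ, inferInstance⟩

/-- In a fibration, cocartesian arrows are strongly cocartesian. -/
lemma isStronglyCocartesian_of_isCocartesian {L J : B} (v : L ⟶ J) {a b : E} (κ : a ⟶ b)
    [p.IsCocartesian v κ] : p.IsStronglyCocartesian v κ where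
  universal_property' {c} g φ hφ := by
    -- An arrow over `v ≫ g` factors through the cartesian lifting of `g`, which leaves an arrow
    -- over `v` itself, where plain cocartesianness applies.
    obtain ⟨c', l, hl⟩ := exists_isStronglyCartesian p g c rfl
    obtain ⟨ψ, ⟨hψl, hψ⟩, hψ'⟩ :=
      Functor.IsStronglyCartesian.universal_property p g l v (v ≫ g) rfl φ
    refine ⟨Functor.IsCocartesian.map p v κ ψ ≫ l, ⟨inferInstance, ?_⟩, ?_⟩
    · rw [Functor.IsCocartesian.fac_assoc, hψ]
    · rintro t ⟨ht, ht'⟩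
      have h1 := Functor.IsCartesian.fac p g l t
      rw [← h1]
      congr 1
      apply Functor.IsCocartesian.map_uniq
      exact hψ' _ ⟨inferInstance, by rw [Category.assoc, h1, ht']⟩

instance coprodArrow_isStronglyCocartesian {L J : B} (v : L ⟶ J) [(reindex p v).IsRightAdjoint]
    (β : p.Fiber L) : p.IsStronglyCocartesian v (coprodArrow p v β) :=
  haveI := coprodArrow_isCocartesian p v β
  isStronglyCocartesian_of_isCocartesian p v _

lemma exchange_fac {K I L J : B} {u : K ⟶ I} {f : I ⟶ J} {g : K ⟶ L} {v : L ⟶ J}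
    (w : u ≫ f = g ≫ v) (X : p.Fiber J) :
    (exchange p w X).1 ≫ lift p u (reindexObj p f X) ≫ lift p f X =
      lift p g (reindexObj p v X) ≫ lift p v X := by
  have h1 : (exchange p w X).1 ≫ lift p u (reindexObj p f X) = exchangeAux p w X :=
    Functor.IsCartesian.fac p u (lift p u (reindexObj p f X)) (exchangeAux p w X)
  have h2 : exchangeAux p w X ≫ lift p f X = liftLift p g v X :=
    Functor.IsStronglyCartesian.fac p f (lift p f X) w.symm (liftLift p g v X)
  exact (Category.assoc _ _ _).symm.trans ((congrArg (· ≫ lift p f X) h1).trans h2)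

/-- This equation frees Beck-Chevalley from the chosen adjoints: the Beck-Chevalley arrow compares
the chosen cocartesian arrow over `u` with the restriction of the one over `v`. -/
lemma coprodArrow_beckChevalley {K I L J : B} {u : K ⟶ I} {f : I ⟶ J} {g : K ⟶ L} {v : L ⟶ J}
    (w : u ≫ f = g ≫ v) [(reindex p u).IsRightAdjoint] [(reindex p v).IsRightAdjoint]
    (β : p.Fiber L) :
    (coprodArrow p u (reindexObj p g β) ≫ (beckChevalley p w β).1) ≫
        lift p f ((coprod p v).obj β) =
      lift p g β ≫ coprodArrow p v β := by
  have h1 : (coprodEquiv p u (reindexObj p g β) _ (beckChevalley p w β)).1 =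
      (reindexMap p g ((coprodAdj p v).unit.app β)).1 ≫ (exchange p w _).1 :=
    congrArg Subtype.val (Equiv.apply_symm_apply ((coprodAdj p u).homEquiv _ _) _)
  have h2 := coprodEquiv_val_comp_lift p u (reindexObj p g β) _ (beckChevalley p w β)
  have h3 := exchange_fac p w ((coprod p v).obj β)
  have h4 : (reindexMap p g ((coprodAdj p v).unit.app β)).1 ≫
      lift p g (reindexObj p v ((coprod p v).obj β)) = lift p g β ≫ coprodUnit p v β :=
    reindexMap_fac p g ((coprodAdj p v).unit.app β)
  refine (congrArg (· ≫ _) (h2.symm.trans (congrArg (· ≫ _) h1))).trans ?_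
  refine (Category.assoc _ _ _).trans ((Category.assoc _ _ _).trans ((congrArg _ h3).trans ?_))
  refine (Category.assoc _ _ _).symm.trans ((congrArg (· ≫ _) h4).trans ?_)
  exact Category.assoc _ _ _

variable (F : MorphismProperty B) [HasCoproducts p F]

/-- Every display map has cocartesian liftings. -/
lemma exists_isStronglyCocartesian {L J : B} (v : L ⟶ J) (hv : F v) (b : E) (hb : p.obj b = L) :
    ∃ (c : E) (κ : b ⟶ c), p.IsStronglyCocartesian v κ :=
  haveI := HasCoproducts.isRightAdjoint (p := p) v hv
  ⟨_, coprodArrow p v ⟨b, hb⟩, coprodArrow_isStronglyCocartesian p v ⟨b, hb⟩⟩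

variable {F} in
-- One Beck-Chevalley square with chosen liftings. Any other is vertically isomorphic to it, which
-- is how the general case below follows.
lemma exists_beckChevalley_square {K I L J : B} {u : K ⟶ I} {f : I ⟶ J} {g : K ⟶ L}
    {v : L ⟶ J} (sq : IsPullback u g f v) (hu : F u) (hv : F v) (β : E) (hβ : p.obj β = L) :
    ∃ (b β' b' : E) (κ : β ⟶ b) (γ : β' ⟶ β) (φ : b' ⟶ b) (κ' : β' ⟶ b'),
      p.IsStronglyCocartesian v κ ∧ p.IsStronglyCartesian g γ ∧ p.IsStronglyCartesian f φ ∧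
        p.IsStronglyCocartesian u κ' ∧ κ' ≫ φ = γ ≫ κ := by
  have := HasCoproducts.isRightAdjoint (p := p) u hu
  have := HasCoproducts.isRightAdjoint (p := p) v hv
  let x : p.Fiber L := ⟨β, hβ⟩
  have hbc := HasCoproducts.isIso_beckChevalley (p := p) sq hu hv x
  let t : (coprod p u).obj (reindexObj p g x) ⟶ reindexObj p f ((coprod p v).obj x) :=
    beckChevalley p sq.w x
  have ht : IsIso t := hbc
  have ht' : IsIso t.1 := inferInstanceAs (IsIso (Functor.Fiber.fiberInclusion.map t))
  exact ⟨_, _, _, coprodArrow p v x, lift p g x, lift p f _, _,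
    coprodArrow_isStronglyCocartesian p v x, inferInstance, inferInstance,
    isStronglyCocartesian_comp_iso p u (coprodArrow p u (reindexObj p g x))
      (coprodArrow_isStronglyCocartesian p u _) t.1 t.2, coprodArrow_beckChevalley p sq.w x⟩

variable {F} in
/-- The Beck-Chevalley condition for arbitrary cartesian and cocartesian arrows: cocartesian arrows
over display maps are stable under pullback. -/
lemma isStronglyCocartesian_of_isPullback {K I L J : B} {u : K ⟶ I} {f : I ⟶ J} {g : K ⟶ L}
    {v : L ⟶ J} (sq : IsPullback u g f v) (hu : F u) (hv : F v) {β b β' b' : E}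
    (κ : β ⟶ b) (hκ : p.IsStronglyCocartesian v κ) (γ : β' ⟶ β) (hγ : p.IsStronglyCartesian g γ)
    (φ : b' ⟶ b) (hφ : p.IsStronglyCartesian f φ) (κ' : β' ⟶ b') (hκ' : p.IsHomLift u κ')
    (w : κ' ≫ φ = γ ≫ κ) : p.IsStronglyCocartesian u κ' := by
  obtain ⟨b₀, β₀, b₀', κ₀, γ₀, φ₀, κ₀', h₁, h₂, h₃, h₄, h₅⟩ :=
    exists_beckChevalley_square p sq hu hv β (IsHomLift.domain_eq p v κ)
  obtain ⟨i, hi, hi'⟩ := exists_iso_of_cocartesian p v κ₀ κ h₁ hκ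
  obtain ⟨j, hj, hj'⟩ := exists_iso_of_cartesian p g γ₀ γ h₂ hγ
  obtain ⟨m, hm, hm'⟩ := exists_iso_of_cartesian p f φ (φ₀ ≫ i.hom) hφ
    (isStronglyCartesian_comp_iso p f _ h₃ _ hi)
  have h : p.IsStronglyCocartesian u (j.hom ≫ κ₀' ≫ m.hom) :=
    isStronglyCocartesian_iso_comp p u _ hj _ (isStronglyCocartesian_comp_iso p u _ h₄ _ hm)
  have hl := h.toIsHomLift
  -- Both sides lie over `u` and have the same composite with the cartesian arrow `φ`.
  have : κ' = j.hom ≫ κ₀' ≫ m.hom := by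
    apply Functor.IsStronglyCartesian.ext p f φ u
    simp only [w, Category.assoc, hm', ← hj', ← hi', reassoc_of% h₅]
  rwa [this]

end Fibration

/-! ### Quantifier-free objects as objects with stable unique lifts -/

section QuantifierFree

variable {B : Type u₁} [Category.{v₁} B] {E : Type u₂} [Category.{v₂} E]
variable (p : E ⥤ B) [p.IsFibered]

lemma reindex_unit_sectionHom_val {L A : B} (u : L ⟶ A) [(reindex p u).IsRightAdjoint]
    (g : A ⟶ L) (hg : g ≫ u = 𝟙 A) (β : p.Fiber L) :
    ((reindex p g).map ((coprodAdj p u).unit.app β) ≫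
        sectionHom p u g hg ((coprod p u).obj β)).1 =
      lift p g β ≫ coprodArrow p u β := by
  have h : (reindexMap p g ((coprodAdj p u).unit.app β)).1 ≫
      lift p g (reindexObj p u ((coprod p u).obj β)) = lift p g β ≫ coprodUnit p u β :=
    reindexMap_fac p g ((coprodAdj p u).unit.app β)
  exact (Category.assoc _ _ _).symm.trans ((congrArg (· ≫ lift p u _) h).trans
    (Category.assoc _ _ _))

/-- The arrow `α ⟶ g^* β ⟶ β` over a section `g` corresponding to a vertical `α ⟶ g^* β`. -/
def splittingArrow {L A : B} {u : L ⟶ A} {α : p.Fiber A} {β : p.Fiber L}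
    (s : (g : {g : A ⟶ L // g ≫ u = 𝟙 A}) × (α ⟶ (reindex p g.1).obj β)) : α.1 ⟶ β.1 :=
  s.2.1 ≫ lift p s.1.1 β

lemma splittingArrow_isHomLift {L A : B} {u : L ⟶ A} {α : p.Fiber A} {β : p.Fiber L}
    (s : (g : {g : A ⟶ L // g ≫ u = 𝟙 A}) × (α ⟶ (reindex p g.1).obj β)) :
    p.IsHomLift s.1.1 (splittingArrow p s) := by
  obtain ⟨g, k⟩ := s
  let k' : α ⟶ reindexObj p g.1 β := k
  have hk : p.IsHomLift (𝟙 A) k'.1 := k'.2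
  have : p.IsHomLift (𝟙 A ≫ g.1) (splittingArrow p ⟨g, k⟩) :=
    IsHomLift.comp p (𝟙 A) g.1 k'.1 (lift p g.1 β)
  rwa [Category.id_comp] at this

/-- The section is recovered as the base of the arrow, and the vertical part by the universal
property of the cartesian lifting. -/
lemma splittingArrow_injective {L A : B} {u : L ⟶ A} {α : p.Fiber A} {β : p.Fiber L} :
    Function.Injective (splittingArrow p (u := u) (α := α) (β := β)) := by
  intro s t h
  have hs := splittingArrow_isHomLift p s
  have ht := splittingArrow_isHomLift p t
  rw [← h] at ht
  have hst := isHomLift_unique p _ hs ht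
  obtain ⟨⟨g, hg⟩, k⟩ := s
  obtain ⟨⟨g', hg'⟩, k'⟩ := t
  obtain rfl : g = g' := hst
  let l : α ⟶ reindexObj p g β := k
  let l' : α ⟶ reindexObj p g β := k'
  have hl : p.IsHomLift (𝟙 A) l.1 := l.2
  have hl' : p.IsHomLift (𝟙 A) l'.1 := l'.2
  have : l = l' := Subtype.ext (Functor.IsCartesian.ext p g (lift p g β) l.1 l'.1 h)
  exact congrArg (Sigma.mk (⟨g, hg⟩ : {g : A ⟶ L // g ≫ u = 𝟙 A})) this

lemma exists_splittingArrow_eq {L A : B} {u : L ⟶ A} {α : p.Fiber A} {β : p.Fiber L}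
    (g : A ⟶ L) (hg : g ≫ u = 𝟙 A) (k : α.1 ⟶ β.1) (hk : p.IsHomLift g k) :
    ∃ s : (g : {g : A ⟶ L // g ≫ u = 𝟙 A}) × (α ⟶ (reindex p g.1).obj β),
      splittingArrow p s = k := by
  obtain ⟨t, ⟨ht, ht'⟩, -⟩ :=
    Functor.IsCartesian.universal_property (p := p) (f := g) (φ := lift p g β) k
  exact ⟨⟨⟨g, hg⟩, ⟨t, ht⟩⟩, ht'⟩

variable (F : MorphismProperty B) [HasCoproducts p F]

/-- The dependent pair becomes a single arrow `k`. The section condition need not be imposed: the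
base `g` of any such `k` satisfies `g ≫ u = 𝟙 A` because `h` is vertical. -/
lemma isQuantifierSplitting_iff_coprodArrow {A : B} (α : p.Fiber A) :
    IsQuantifierSplitting p F α ↔ ∀ {L : B} (u : L ⟶ A) (hu : F u) (β : p.Fiber L),
      haveI : (reindex p u).IsRightAdjoint := HasCoproducts.isRightAdjoint u hu
      ∀ h : α ⟶ (coprod p u).obj β, ∃! k : α.1 ⟶ β.1, k ≫ coprodArrow p u β = h.1 := by
  refine forall_congr' fun L => forall_congr' fun u => forall_congr' fun hu =>
    forall_congr' fun β => forall_congr' fun h => ?_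
  have := HasCoproducts.isRightAdjoint (p := p) u hu
  have key : ∀ s : (g : {g : A ⟶ L // g ≫ u = 𝟙 A}) × (α ⟶ (reindex p g.1).obj β),
      h = s.2 ≫ (reindex p s.1.1).map ((coprodAdj p u).unit.app β) ≫
          sectionHom p u s.1.1 s.1.2 ((coprod p u).obj β) ↔
        splittingArrow p s ≫ coprodArrow p u β = h.1 := by
    intro s
    have h1 : (s.2 ≫ (reindex p s.1.1).map ((coprodAdj p u).unit.app β) ≫
        sectionHom p u s.1.1 s.1.2 ((coprod p u).obj β)).1 =
          splittingArrow p s ≫ coprodArrow p u β :=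
      (congrArg (s.2.1 ≫ ·) (reindex_unit_sectionHom_val p u s.1.1 s.1.2 β)).trans
        (Category.assoc _ _ _).symm
    rw [← h1]
    exact ⟨fun h => by rw [← h], fun h => Subtype.ext h.symm⟩
  have lifts : ∀ k : α.1 ⟶ β.1, k ≫ coprodArrow p u β = h.1 →
      ∃ s : (g : {g : A ⟶ L // g ≫ u = 𝟙 A}) × (α ⟶ (reindex p g.1).obj β),
        splittingArrow p s = k := by
    intro k hk
    obtain ⟨g, hg⟩ := exists_isHomLift p k α.2 β.2
    refine exists_splittingArrow_eq p g ?_ k hg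
    have h1 : p.IsHomLift (g ≫ u) (k ≫ coprodArrow p u β) := inferInstance
    rw [hk] at h1
    exact isHomLift_unique p _ h1 h.2
  constructor
  · rintro ⟨s, hs, hs'⟩
    refine ⟨splittingArrow p s, (key s).1 hs, fun k hk => ?_⟩
    obtain ⟨t, rfl⟩ := lifts k hk
    rw [hs' t ((key t).2 hk)]
  · rintro ⟨k, hk, hk'⟩
    obtain ⟨s, rfl⟩ := lifts k hk
    exact ⟨s, (key s).2 hk, fun t ht => splittingArrow_injective p (hk' _ ((key t).1 ht))⟩

variable {F}

/-- For an arrow `h` over `f`, lifting `h` along `κ` amounts to lifting its vertical part `h'` along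
the pullback `κ'` of `κ` over `f`. By Beck-Chevalley `κ'` is again cocartesian over a display map,
hence a coproduct arrow up to vertical isomorphism. -/
lemma isQuantifierSplitting_iff (hF : IsDisplayMapClass F) {A : B} (α : p.Fiber A) :
    IsQuantifierSplitting p F α ↔ HasUniqueLifts p F α.1 := by
  rw [isQuantifierSplitting_iff_coprodArrow]
  constructor
  · intro H R S u hu c d κ hκ h
    obtain ⟨f, hf⟩ := exists_isHomLift p h α.2 (IsHomLift.codomain_eq p u κ)
    have := hF.hasPullback f u hu
    have sq : IsPullback (Limits.pullback.fst f u) (Limits.pullback.snd f u) f u :=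
      IsPullback.of_hasPullback f u
    have hu' : F (Limits.pullback.fst f u) := hF.of_isPullback sq.flip hu
    obtain ⟨d', φ, hφ⟩ := exists_isStronglyCartesian p f d (IsHomLift.codomain_eq p u κ)
    obtain ⟨c', γ, hγ⟩ := exists_isStronglyCartesian p (Limits.pullback.snd f u) c
      (IsHomLift.domain_eq p u κ)
    obtain ⟨κ', ⟨hκ', w⟩, -⟩ := Functor.IsStronglyCartesian.universal_property p f φ _ _
      sq.w.symm (γ ≫ κ)
    have hκc := isStronglyCocartesian_of_isPullback p sq hu' hu κ hκ γ hγ φ hφ κ' hκ' w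
    let β : p.Fiber (Limits.pullback f u) := ⟨c', IsHomLift.domain_eq p (Limits.pullback.snd f u) γ⟩
    have := HasCoproducts.isRightAdjoint (p := p) _ hu'
    obtain ⟨i, hi, hi'⟩ := exists_iso_of_cocartesian p _ κ' (coprodArrow p _ β) hκc
      (coprodArrow_isStronglyCocartesian p _ β)
    obtain ⟨h', ⟨hh', wh'⟩, -⟩ :=
      Functor.IsCartesian.universal_property (p := p) (f := f) (φ := φ) h
    obtain ⟨k, hk, hk'⟩ := H _ hu' β ⟨h' ≫ i.hom, inferInstance⟩
    have hk1 : k ≫ κ' = h' := by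
      rw [← cancel_mono i.hom, Category.assoc, hi']
      exact hk
    refine ⟨k ≫ γ, by simp only [Category.assoc, ← w, reassoc_of% hk1, wh'], ?_⟩
    intro l hl
    obtain ⟨g, hg⟩ := exists_isHomLift p l α.2 (IsHomLift.domain_eq p u κ)
    have hgu : 𝟙 A ≫ f = g ≫ u := by
      have h1 : p.IsHomLift (g ≫ u) (l ≫ κ) := inferInstance
      rw [hl] at h1
      rw [Category.id_comp]
      exact isHomLift_unique p _ hf h1
    -- A competing lift `l` over `g` factors through `γ` over the section `(𝟙, g)` of the
    -- pulled-back display map; the factor `m` lifts `h'`, so it equals `k`.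
    obtain ⟨m, ⟨hm, hm'⟩, -⟩ := Functor.IsStronglyCartesian.universal_property p _ γ
      (sq.lift (𝟙 A) g hgu) g (sq.lift_snd _ _ _).symm l
    have h2 : p.IsHomLift (𝟙 A) (m ≫ κ') := by
      have : p.IsHomLift (sq.lift (𝟙 A) g hgu ≫ Limits.pullback.fst f u) (m ≫ κ') := inferInstance
      rwa [sq.lift_fst] at this
    have h3 : m ≫ κ' = h' := by
      apply Functor.IsCartesian.ext p f φ
      rw [Category.assoc, w, reassoc_of% hm', hl, wh']
    rw [← hk' m ?_, hm']
    change m ≫ coprodArrow p _ β = h' ≫ i.hom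
    rw [← hi', reassoc_of% h3]
  · intro H L u hu β h
    have := HasCoproducts.isRightAdjoint (p := p) u hu
    exact H u hu (coprodArrow p u β) (coprodArrow_isStronglyCocartesian p u β) h.1

lemma isQuantifierFree_iff (hF : IsDisplayMapClass F) {A : B} (α : p.Fiber A) :
    IsQuantifierFree p F α ↔ HasStableUniqueLifts p F α.1 := by
  constructor
  · intro H R S f a' φ hφ
    obtain rfl : S = A := (IsHomLift.codomain_eq p f φ).symm.trans α.2
    obtain ⟨i, -⟩ := exists_iso_of_cartesian p f (lift p f α) φ inferInstance hφ
    exact ((isQuantifierSplitting_iff p hF _).1 (H f)).of_iso i.symm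
  · intro H I f
    exact (isQuantifierSplitting_iff p hF _).2 (H f (lift p f α) inferInstance)

lemma quantifierFree_iff (hF : IsDisplayMapClass F) (a : E) :
    quantifierFree p F a ↔ HasStableUniqueLifts p F a :=
  isQuantifierFree_iff p hF (⟨a, rfl⟩ : p.Fiber (p.obj a))

/-- Enough quantifier-free objects, in terms of cocartesian arrows. -/
lemma enoughQuantifierFree_iff (hF : IsDisplayMapClass F) :
    EnoughQuantifierFree p F ↔ ∀ a : E, ∃ (A : B) (f : A ⟶ p.obj a) (b : E) (κ : b ⟶ a),
      F f ∧ HasStableUniqueLifts p F b ∧ p.IsStronglyCocartesian f κ := by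
  constructor
  · intro H a
    obtain ⟨A, f, hf, β, hβ, ⟨i⟩⟩ := H (⟨a, rfl⟩ : p.Fiber (p.obj a))
    have := HasCoproducts.isRightAdjoint (p := p) f hf
    have hi : IsIso i.inv.1 :=
      ⟨i.hom.1, congrArg Subtype.val i.inv_hom_id, congrArg Subtype.val i.hom_inv_id⟩
    exact ⟨A, f, β.1, coprodArrow p f β ≫ i.inv.1, hf, (isQuantifierFree_iff p hF β).1 hβ,
      isStronglyCocartesian_comp_iso p f _ (coprodArrow_isStronglyCocartesian p f β) _ i.inv.2⟩
  · rintro H I ⟨a, rfl⟩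
    obtain ⟨A, f, b, κ, hf, hb, hκ⟩ := H a
    have := HasCoproducts.isRightAdjoint (p := p) f hf
    let β : p.Fiber A := ⟨b, IsHomLift.domain_eq p f κ⟩
    refine ⟨A, f, hf, β, (isQuantifierFree_iff p hF β).2 hb, ?_⟩
    obtain ⟨i, hi, -⟩ := exists_iso_of_cocartesian p f κ (coprodArrow p f β) hκ
      (coprodArrow_isStronglyCocartesian p f β)
    have hi' : p.IsHomLift (𝟙 (p.obj a)) i.inv := inferInstance
    exact ⟨⟨⟨i.hom, hi⟩, ⟨i.inv, hi'⟩, Subtype.ext i.hom_inv_id, Subtype.ext i.inv_hom_id⟩⟩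

/-! ### The subfibration of quantifier-free objects -/

lemma qfProj_isHomLift_iff {R S : B} (f : R ⟶ S) {a b : (quantifierFree p F).FullSubcategory}
    (φ : a ⟶ b) : (qfProj p F).IsHomLift f φ ↔ p.IsHomLift f φ.hom :=
  (BasedFunctor.isHomLift_iff (qfIncl p F) f φ).symm

lemma qfProj_isStronglyCartesian {R S : B} (f : R ⟶ S)
    {a b : (quantifierFree p F).FullSubcategory} (φ : a ⟶ b)
    (hφ : p.IsStronglyCartesian f φ.hom) : (qfProj p F).IsStronglyCartesian f φ where
  toIsHomLift := (qfProj_isHomLift_iff p f φ).2 inferInstance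
  universal_property' {c} g ψ hψ := by
    have hψ' := (qfProj_isHomLift_iff p _ ψ).1 hψ
    obtain ⟨χ, ⟨hχ, hχ'⟩, huniq⟩ := Functor.IsStronglyCartesian.universal_property p f φ.hom g
      (g ≫ f) rfl ψ.hom
    refine ⟨⟨χ⟩, ⟨(qfProj_isHomLift_iff p g _).2 hχ, ?_⟩, ?_⟩
    · ext
      exact hχ'
    · rintro t ⟨ht, rfl⟩
      ext
      exact huniq t.hom ⟨(qfProj_isHomLift_iff p g t).1 ht, rfl⟩

lemma exists_qfProj_cartesian (hF : IsDisplayMapClass F) {R S : B} (f : R ⟶ S)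
    (b : (quantifierFree p F).FullSubcategory) (hb : p.obj b.obj = S) :
    ∃ (a : (quantifierFree p F).FullSubcategory) (φ : a ⟶ b), p.IsStronglyCartesian f φ.hom := by
  obtain ⟨a, φ, hφ⟩ := exists_isStronglyCartesian p f b.obj hb
  refine ⟨⟨a, ?_⟩, ⟨φ⟩, hφ⟩
  rw [quantifierFree_iff p hF]
  exact ((quantifierFree_iff p hF _).1 b.property).of_cartesian f φ hφ

lemma qfProj_isFibered (hF : IsDisplayMapClass F) : (qfProj p F).IsFibered :=
  Functor.IsFibered.of_exists_isStronglyCartesian fun b R f => by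
    obtain ⟨a, φ, hφ⟩ := exists_qfProj_cartesian p hF f b rfl
    exact ⟨a, φ, qfProj_isStronglyCartesian p f φ hφ⟩

/-- Cartesianness in the subcategory is tested against fewer objects. But some lifting in the
subcategory is already cartesian for `p`, and the given one differs from it by a vertical
isomorphism. -/
lemma isStronglyCartesian_of_qfProj (hF : IsDisplayMapClass F) {R S : B} (f : R ⟶ S)
    {a b : (quantifierFree p F).FullSubcategory} (φ : a ⟶ b)
    (hφ : (qfProj p F).IsStronglyCartesian f φ) : p.IsStronglyCartesian f φ.hom := by
  obtain ⟨a', φ', hφ'⟩ := exists_qfProj_cartesian p hF f b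
    (IsHomLift.codomain_eq (qfProj p F) f φ)
  obtain ⟨i, hi, rfl⟩ := exists_iso_of_cartesian (qfProj p F) f φ' φ
    (qfProj_isStronglyCartesian p f φ' hφ') hφ
  have : IsIso i.hom.hom := inferInstanceAs (IsIso ((quantifierFree p F).ι.map i.hom))
  exact isStronglyCartesian_iso_comp p f i.hom.hom ((qfProj_isHomLift_iff p _ _).1 hi) _ hφ'

lemma qfIncl_isFibredFunctor (hF : IsDisplayMapClass F) : IsFibredFunctor (qfIncl p F) :=
  fun f _ _ φ hφ => isStronglyCartesian_of_qfProj p hF f φ hφ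

end QuantifierFree

/-! ### Equivalences over the base -/

section VerticalEquivalence

variable {B : Type u₁} [Category.{v₁} B] {X : Type u₂} [Category.{v₂} X] {Y : Type u₃}
  [Category.{v₃} Y] {r : X ⥤ B} {s : Y ⥤ B} {G : X ⥤ Y}

lemma isHomLift_map_iff (hG : G ⋙ s = r) {R S : B} (f : R ⟶ S) {a b : X} (φ : a ⟶ b) :
    s.IsHomLift f (G.map φ) ↔ r.IsHomLift f φ :=
  BasedFunctor.isHomLift_iff (𝒳 := .ofFunctor r) (𝒴 := .ofFunctor s) ⟨G, hG⟩ f φ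

/-- A fully faithful functor over the base hitting every object up to vertical isomorphism. -/
structure IsVerticalEquivalence (s : Y ⥤ B) (G : X ⥤ Y) : Prop where
  full : G.Full
  faithful : G.Faithful
  exists_iso : ∀ y : Y, ∃ (x : X) (i : G.obj x ≅ y), s.IsHomLift (𝟙 (s.obj y)) i.hom

lemma isHomLift_inv_id {R : B} {a b : X} (i : a ≅ b) (hi : r.IsHomLift (𝟙 R) i.hom) :
    r.IsHomLift (𝟙 R) i.inv :=
  inferInstance

lemma isStronglyCartesian_of_map [G.Full] [G.Faithful] (hG : G ⋙ s = r) {R S : B} (f : R ⟶ S)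
    {a b : X} (φ : a ⟶ b) (hφ : s.IsStronglyCartesian f (G.map φ)) :
    r.IsStronglyCartesian f φ where
  toIsHomLift := (isHomLift_map_iff hG f φ).1 hφ.toIsHomLift
  universal_property' {c} g ψ hψ := by
    have hψ' := (isHomLift_map_iff hG _ ψ).2 hψ
    obtain ⟨χ, ⟨hχ, hχ'⟩, huniq⟩ := Functor.IsStronglyCartesian.universal_property s f (G.map φ) g
      (g ≫ f) rfl (G.map ψ)
    obtain ⟨χ, rfl⟩ := G.map_surjective χ
    refine ⟨χ, ⟨(isHomLift_map_iff hG g χ).1 hχ, G.map_injective (by rw [G.map_comp, hχ'])⟩, ?_⟩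
    rintro t ⟨ht, rfl⟩
    exact G.map_injective (huniq _ ⟨(isHomLift_map_iff hG g t).2 ht, by rw [G.map_comp]⟩)

lemma isStronglyCocartesian_of_map [G.Full] [G.Faithful] (hG : G ⋙ s = r) {R S : B} (f : R ⟶ S)
    {a b : X} (φ : a ⟶ b) (hφ : s.IsStronglyCocartesian f (G.map φ)) :
    r.IsStronglyCocartesian f φ where
  toIsHomLift := (isHomLift_map_iff hG f φ).1 hφ.toIsHomLift
  universal_property' {c} g ψ hψ := by
    have hψ' := (isHomLift_map_iff hG _ ψ).2 hψ
    obtain ⟨χ, ⟨hχ, hχ'⟩, huniq⟩ := Functor.IsStronglyCocartesian.universal_property s f (G.map φ)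
      g (f ≫ g) rfl (G.map ψ)
    obtain ⟨χ, rfl⟩ := G.map_surjective χ
    refine ⟨χ, ⟨(isHomLift_map_iff hG g χ).1 hχ, G.map_injective (by rw [G.map_comp, hχ'])⟩, ?_⟩
    rintro t ⟨ht, rfl⟩
    exact G.map_injective (huniq _ ⟨(isHomLift_map_iff hG g t).2 ht, by rw [G.map_comp]⟩)

/-- A test object of `Y` may be replaced by a vertically isomorphic value of `G`, and fullness then
moves the test arrow to `X`. -/
lemma IsVerticalEquivalence.isStronglyCartesian_map (h : IsVerticalEquivalence s G)
    (hG : G ⋙ s = r) {R S : B} (f : R ⟶ S) {a b : X} (φ : a ⟶ b)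
    (hφ : r.IsStronglyCartesian f φ) : s.IsStronglyCartesian f (G.map φ) where
  toIsHomLift := (isHomLift_map_iff hG f φ).2 inferInstance
  universal_property' {c} g ψ hψ := by
    have := h.full
    have := h.faithful
    obtain ⟨x, i, hi⟩ := h.exists_iso c
    have hi' := isHomLift_inv_id i hi
    obtain ⟨ψ', hψ'⟩ := G.map_surjective (i.hom ≫ ψ)
    have h1 : r.IsHomLift (g ≫ f) ψ' := by
      rw [← isHomLift_map_iff hG, hψ']
      infer_instance
    obtain ⟨χ, ⟨hχ, hχ'⟩, huniq⟩ := Functor.IsStronglyCartesian.universal_property r f φ g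
      (g ≫ f) rfl ψ'
    have h2 := (isHomLift_map_iff hG g χ).2 hχ
    refine ⟨i.inv ≫ G.map χ, ⟨inferInstance, ?_⟩, ?_⟩
    · rw [Category.assoc, ← G.map_comp, hχ', hψ', Iso.inv_hom_id_assoc]
    · rintro t ⟨ht, rfl⟩
      obtain ⟨t', ht'⟩ := G.map_surjective (i.hom ≫ t)
      rw [Iso.eq_inv_comp, ← ht']
      refine congrArg _ (huniq t' ⟨?_, G.map_injective ?_⟩)
      · rw [← isHomLift_map_iff hG, ht']
        infer_instance
      · rw [G.map_comp, ht', hψ', Category.assoc]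

lemma IsVerticalEquivalence.isStronglyCocartesian_map (h : IsVerticalEquivalence s G)
    (hG : G ⋙ s = r) {R S : B} (f : R ⟶ S) {a b : X} (φ : a ⟶ b)
    (hφ : r.IsStronglyCocartesian f φ) : s.IsStronglyCocartesian f (G.map φ) where
  toIsHomLift := (isHomLift_map_iff hG f φ).2 inferInstance
  universal_property' {c} g ψ hψ := by
    have := h.full
    have := h.faithful
    obtain ⟨x, i, hi⟩ := h.exists_iso c
    have hi' := isHomLift_inv_id i hi
    obtain ⟨ψ', hψ'⟩ := G.map_surjective (ψ ≫ i.inv)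
    have h1 : r.IsHomLift (f ≫ g) ψ' := by
      rw [← isHomLift_map_iff hG, hψ']
      infer_instance
    obtain ⟨χ, ⟨hχ, hχ'⟩, huniq⟩ := Functor.IsStronglyCocartesian.universal_property r f φ g
      (f ≫ g) rfl ψ'
    have h2 := (isHomLift_map_iff hG g χ).2 hχ
    refine ⟨G.map χ ≫ i.hom, ⟨inferInstance, ?_⟩, ?_⟩
    · rw [← Category.assoc, ← G.map_comp, hχ', hψ', Category.assoc, Iso.inv_hom_id,
        Category.comp_id]
    · rintro t ⟨ht, rfl⟩
      obtain ⟨t', ht'⟩ := G.map_surjective (t ≫ i.inv)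
      rw [← Iso.comp_inv_eq, ← ht']
      refine congrArg _ (huniq t' ⟨?_, G.map_injective ?_⟩)
      · rw [← isHomLift_map_iff hG, ht']
        infer_instance
      · rw [G.map_comp, ht', hψ', Category.assoc]

/-! ### Quasi-inverse, unit and counit of a vertical equivalence. -/

namespace IsVerticalEquivalence

variable (h : IsVerticalEquivalence s G)

/-- A chosen preimage, up to vertical isomorphism. -/
def preimageObj (y : Y) : X := (h.exists_iso y).choose

/-- The vertical isomorphism from the image of the chosen preimage. -/
def preimageObjIso (y : Y) : G.obj (h.preimageObj y) ≅ y := (h.exists_iso y).choose_spec.choose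

/-- The quasi-inverse of a vertical equivalence. -/
def inverse : Y ⥤ X :=
  haveI := h.full
  haveI := h.faithful
  { obj := h.preimageObj
    map := fun {y z} φ => G.preimage ((h.preimageObjIso y).hom ≫ φ ≫ (h.preimageObjIso z).inv)
    map_id := fun y => G.map_injective (by simp)
    map_comp := fun φ ψ => G.map_injective (by simp) }

/-- The component at `y` of the counit of the equivalence. -/
def counitIso (y : Y) : G.obj (h.inverse.obj y) ≅ y := h.preimageObjIso y

lemma counitIso_isHomLift (y : Y) : s.IsHomLift (𝟙 (s.obj y)) (h.counitIso y).hom :=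
  (h.exists_iso y).choose_spec.choose_spec

lemma map_inverse_map {y z : Y} (φ : y ⟶ z) :
    G.map (h.inverse.map φ) = (h.counitIso y).hom ≫ φ ≫ (h.counitIso z).inv :=
  haveI := h.full
  G.map_preimage _

lemma inverse_isHomLift (hG : G ⋙ s = r) {y z : Y} (φ : y ⟶ z) :
    r.IsHomLift (s.map φ) (h.inverse.map φ) := by
  have h1 := h.counitIso_isHomLift y
  have h2 := isHomLift_inv_id _ (h.counitIso_isHomLift z)
  rw [← isHomLift_map_iff hG, h.map_inverse_map]
  infer_instance

/-- Functors over `B` commute with the projections strictly. The chosen preimages do lie over the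
right objects because the isomorphisms choosing them are vertical. -/
lemma inverse_comp (hG : G ⋙ s = r) : h.inverse ⋙ r = s :=
  CategoryTheory.Functor.ext (fun y =>
    have := h.inverse_isHomLift hG (𝟙 y)
    IsHomLift.domain_eq r (s.map (𝟙 y)) (h.inverse.map (𝟙 y))) fun _ _ φ =>
      have := h.inverse_isHomLift hG φ
      IsHomLift.fac' r (s.map φ) (h.inverse.map φ)

lemma isStronglyCartesian_inverse_map (hG : G ⋙ s = r) {R S : B} (f : R ⟶ S) {y z : Y}
    (φ : y ⟶ z) (hφ : s.IsStronglyCartesian f φ) :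
    r.IsStronglyCartesian f (h.inverse.map φ) := by
  have := h.full
  have := h.faithful
  have h1 := h.counitIso_isHomLift y
  have h2 := isHomLift_inv_id _ (h.counitIso_isHomLift z)
  rw [IsHomLift.domain_eq s f φ] at h1
  rw [IsHomLift.codomain_eq s f φ] at h2
  apply isStronglyCartesian_of_map hG
  rw [h.map_inverse_map]
  exact isStronglyCartesian_iso_comp s f _ h1 _ (isStronglyCartesian_comp_iso s f _ hφ _ h2)

/-- The counit of the equivalence. -/
def counitNatIso : h.inverse ⋙ G ≅ 𝟭 Y :=
  NatIso.ofComponents h.counitIso fun {y z} φ => by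
    change G.map (h.inverse.map φ) ≫ _ = _ ≫ φ
    rw [h.map_inverse_map]
    simp

/-- The unit of the equivalence. -/
def unitNatIso : G ⋙ h.inverse ≅ 𝟭 X :=
  haveI := h.full
  haveI := h.faithful
  NatIso.ofComponents
    (fun x => (G.preimageIso (h.counitIso (G.obj x)) : h.inverse.obj (G.obj x) ≅ x))
    fun {x y} φ => by
      apply G.map_injective
      change G.map (h.inverse.map (G.map φ) ≫ _) = G.map (_ ≫ φ)
      rw [G.map_comp, h.map_inverse_map]
      simp

lemma map_unitNatIso_hom_app (x : X) :
    G.map (h.unitNatIso.hom.app x) = (h.counitIso (G.obj x)).hom :=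
  haveI := h.full
  G.map_preimage _

lemma unitNatIso_isHomLift (hG : G ⋙ s = r) (x : X) :
    r.IsHomLift (𝟙 (r.obj x)) (h.unitNatIso.hom.app x) := by
  have h1 := h.counitIso_isHomLift (G.obj x)
  rw [← isHomLift_map_iff hG, h.map_unitNatIso_hom_app]
  subst hG
  exact h1

end IsVerticalEquivalence

/-- A vertical equivalence is an equivalence of fibrations. -/
lemma IsVerticalEquivalence.isFibredEquivalence (h : IsVerticalEquivalence s G)
    (hG : G ⋙ s = r) :
    IsFibredEquivalence (X := .ofFunctor r) (Y := .ofFunctor s) ⟨G, hG⟩ := by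
  refine ⟨fun f _ _ φ hφ => h.isStronglyCartesian_map hG f φ hφ,
    ⟨h.inverse, h.inverse_comp hG⟩, fun f _ _ φ hφ => h.isStronglyCartesian_inverse_map hG f φ hφ,
    ⟨BasedNatIso.mkNatIso h.unitNatIso fun x =>
      h.unitNatIso_isHomLift hG x⟩,
    ⟨BasedNatIso.mkNatIso h.counitNatIso fun y => h.counitIso_isHomLift y⟩⟩

/-- An equivalence of fibrations is a vertical equivalence. -/
lemma IsFibredEquivalence.isVerticalEquivalence {𝒳 : BasedCategory.{v₂, u₂} B}
    {𝒴 : BasedCategory.{v₃, u₃} B} {G : 𝒳 ⥤ᵇ 𝒴} (h : IsFibredEquivalence G) :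
    IsVerticalEquivalence 𝒴.p G.toFunctor := by
  obtain ⟨-, H, -, ⟨i⟩, ⟨j⟩⟩ := h
  let i' : G.toFunctor ⋙ H.toFunctor ≅ 𝟭 _ := (BasedNatTrans.forgetful 𝒳 𝒳).mapIso i
  let j' : H.toFunctor ⋙ G.toFunctor ≅ 𝟭 _ := (BasedNatTrans.forgetful 𝒴 𝒴).mapIso j
  let e : 𝒳.obj ≌ 𝒴.obj := CategoryTheory.Equivalence.mk G.toFunctor H.toFunctor i'.symm j'
  exact ⟨inferInstanceAs e.functor.Full, inferInstanceAs e.functor.Faithful,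
    fun y => ⟨H.obj y, j'.app y, j.hom.isHomLift' y⟩⟩

/-! ### Transport of unique lifts along an equivalence -/

lemma IsVerticalEquivalence.exists_arrow_iso (h : IsVerticalEquivalence s G)
    {R S : B} (f : R ⟶ S) {y z : Y} (φ : y ⟶ z) (hφ : s.IsHomLift f φ) :
    ∃ (a b : X) (ψ : a ⟶ b) (i : G.obj a ≅ y) (j : G.obj b ≅ z),
      s.IsHomLift (𝟙 R) i.hom ∧ s.IsHomLift (𝟙 S) j.hom ∧ i.hom ≫ φ = G.map ψ ≫ j.hom := by
  obtain rfl := IsHomLift.domain_eq s f φ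
  obtain rfl := IsHomLift.codomain_eq s f φ
  have := h.full
  obtain ⟨a, i, hi⟩ := h.exists_iso y
  obtain ⟨b, j, hj⟩ := h.exists_iso z
  obtain ⟨ψ, hψ⟩ := G.map_surjective (i.hom ≫ φ ≫ j.inv)
  exact ⟨a, b, ψ, i, j, hi, hj, by rw [hψ]; simp⟩

/-- The test arrow `κ` is vertically isomorphic to some `G.map κ'`. Since `G` reflects cocartesian
arrows, the lifting problem can be solved against `κ'` in `X`. -/
lemma IsVerticalEquivalence.hasUniqueLifts_map (h : IsVerticalEquivalence s G) (hG : G ⋙ s = r)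
    {F : MorphismProperty B} {a : X} (ha : HasUniqueLifts r F a) :
    HasUniqueLifts s F (G.obj a) := by
  intro R S u hu c d κ hκ t
  have := h.full
  have := h.faithful
  obtain ⟨c', d', κ', i, j, hi, hj, w⟩ := h.exists_arrow_iso u κ inferInstance
  have hκ' : r.IsStronglyCocartesian u κ' := by
    apply isStronglyCocartesian_of_map hG
    have h1 := isStronglyCocartesian_comp_iso s u _
      (isStronglyCocartesian_iso_comp s u _ hi κ hκ) j.inv (isHomLift_inv_id j hj)
    rwa [w, Category.assoc, Iso.hom_inv_id, Category.comp_id] at h1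
  obtain ⟨t', ht'⟩ := G.map_surjective (t ≫ j.inv)
  obtain ⟨k, hk, huniq⟩ := ha u hu κ' hκ' t'
  refine ⟨G.map k ≫ i.hom, ?_, ?_⟩
  · simp only [Category.assoc, w]
    rw [← G.map_comp_assoc, hk, ht', Category.assoc, Iso.inv_hom_id, Category.comp_id]
  · rintro l rfl
    obtain ⟨l', hl'⟩ := G.map_surjective (l ≫ i.inv)
    rw [← Iso.comp_inv_eq, ← hl']
    refine congrArg _ (huniq l' (G.map_injective ?_))
    rw [G.map_comp, hl', ht', ← cancel_mono j.hom]
    simp [← w]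

lemma IsVerticalEquivalence.hasStableUniqueLifts_map (h : IsVerticalEquivalence s G)
    (hG : G ⋙ s = r) {F : MorphismProperty B} {a : X} (ha : HasStableUniqueLifts r F a) :
    HasStableUniqueLifts s F (G.obj a) := by
  intro R S f y φ hφ
  have := h.full
  have := h.faithful
  obtain rfl := IsHomLift.domain_eq s f φ
  obtain ⟨a', i, hi⟩ := h.exists_iso y
  obtain ⟨ψ, hψ⟩ := G.map_surjective (i.hom ≫ φ)
  refine (h.hasUniqueLifts_map hG (ha f ψ ?_)).of_iso i
  apply isStronglyCartesian_of_map hG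
  rw [hψ]
  exact isStronglyCartesian_iso_comp s f _ hi φ hφ

end VerticalEquivalence

/-! ### Cartesian and cocartesian arrows of the completion -/

section CompletionArrows

variable {B : Type u₁} [Category.{v₁} B] {D : Type u₂} [Category.{v₂} D]
variable {F : MorphismProperty B} {q : D ⥤ B}

namespace Completion

@[simp]
lemma id_hom (x : Completion F q) : Hom.hom (𝟙 x) = 𝟙 x.obj := rfl

@[simp]
lemma comp_hom {x y z : Completion F q} (a : x ⟶ y) (b : y ⟶ z) :
    Hom.hom (a ≫ b) = Hom.hom a ≫ Hom.hom b := rfl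

lemma hom_ext {x y : Completion F q} {a b : x ⟶ y} (h₁ : Hom.base a = Hom.base b)
    (h₂ : Hom.hom a = Hom.hom b) : a = b :=
  Completion.Hom.ext h₁ h₂

instance isHomLift_base {x y : Completion F q} (a : x ⟶ y) :
    (completionProj F q).IsHomLift (Hom.base a) a :=
  inferInstanceAs ((completionProj F q).IsHomLift ((completionProj F q).map a) a)

lemma eq_base {x y : Completion F q} (f : x.base ⟶ y.base) (a : x ⟶ y)
    (h : (completionProj F q).IsHomLift f a) : f = Hom.base a :=
  isHomLift_unique _ a h (isHomLift_base a)

/-- The projection to the category in which the completion is built. -/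
def forget (F : MorphismProperty B) (q : D ⥤ B) : Completion F q ⥤ D where
  obj x := x.obj
  map a := Hom.hom a

lemma isIso_hom {x y : Completion F q} (a : x ⟶ y) [IsIso a] : IsIso (Hom.hom a) :=
  inferInstanceAs (IsIso ((forget F q).map a))

/-- The base component of `c` is prescribed, the pullback determines the arrow between domains of
display maps, and cartesianness of `Hom.hom a` then determines the total component. -/
lemma existsUnique_of_isPullback {x y z : Completion F q} (a : x ⟶ y)
    (sq : IsPullback (q.map (Hom.hom a)) x.disp y.disp (Hom.base a))
    (h : q.IsStronglyCartesian (q.map (Hom.hom a)) (Hom.hom a)) (g : z.base ⟶ x.base) (b : z ⟶ y)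
    (hb : g ≫ Hom.base a = Hom.base b) :
    ∃! c : z ⟶ x, (completionProj F q).IsHomLift g c ∧ c ≫ a = b := by
  have w : q.map (Hom.hom b) ≫ y.disp = (z.disp ≫ g) ≫ Hom.base a := by
    rw [Category.assoc, hb]
    exact Hom.w b
  obtain ⟨χ, ⟨hχ, hχ'⟩, huniq⟩ := Functor.IsStronglyCartesian.universal_property q
    (q.map (Hom.hom a)) (Hom.hom a) (sq.lift _ _ w) _ (sq.lift_fst _ _ w).symm (Hom.hom b)
  have hχq : sq.lift _ _ w = q.map χ := IsHomLift.eq_of_isHomLift q _ χ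
  let c : z ⟶ x := (⟨g, χ, by rw [← hχq, sq.lift_snd]⟩ : Completion.Hom z x)
  refine ⟨c, ⟨isHomLift_base c, hom_ext hb hχ'⟩, ?_⟩
  rintro t ⟨ht, rfl⟩
  obtain rfl : g = Hom.base t := eq_base g t ht
  refine hom_ext rfl (huniq _ ⟨?_, rfl⟩)
  have : sq.lift _ _ w = q.map (Hom.hom t) :=
    sq.hom_ext (by rw [sq.lift_fst, comp_hom, q.map_comp])
      (by rw [sq.lift_snd]; exact (Hom.w t).symm)
  rw [this]
  infer_instance

/-- Pullback squares together with cartesian arrows give cartesian arrows of the completion. -/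
lemma isStronglyCartesian {x y : Completion F q} (a : x ⟶ y)
    (sq : IsPullback (q.map (Hom.hom a)) x.disp y.disp (Hom.base a))
    (h : q.IsStronglyCartesian (q.map (Hom.hom a)) (Hom.hom a)) :
    (completionProj F q).IsStronglyCartesian (Hom.base a) a where
  universal_property' {z} g b hb :=
    existsUnique_of_isPullback a sq h g b (eq_base (x := z) (y := y) _ b hb)

lemma exists_pullback (hF : IsDisplayMapClass F) (hq : q.IsFibered) (y : Completion F q) {R : B}
    (f : R ⟶ y.base) :
    ∃ (d : D) (φ : d ⟶ y.obj) (g : q.obj d ⟶ R), F g ∧ IsPullback (q.map φ) g y.disp f ∧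
      q.IsStronglyCartesian (q.map φ) φ := by
  obtain ⟨P, g, h, sq⟩ : ∃ (P : B) (g : P ⟶ R) (h : P ⟶ q.obj y.obj),
      IsPullback h g y.disp f := by
    have := hF.hasPullback f y.disp y.mem
    exact ⟨_, _, _, (IsPullback.of_hasPullback f y.disp).flip⟩
  obtain ⟨d, φ, hφ⟩ := exists_isStronglyCartesian q h y.obj rfl
  -- The domain of a display map is `q.obj` of the total object by definition, so the pullback
  -- vertex has to be replaced by `q.obj d`.
  obtain rfl := IsHomLift.domain_eq q h φ
  obtain rfl := IsHomLift.eq_of_isHomLift q h φ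
  exact ⟨d, φ, g, hF.of_isPullback sq y.mem, sq, hφ⟩

/-- Up to vertical isomorphism, cartesian arrows of the completion are pullback squares together
with cartesian arrows. -/
lemma exists_iso_of_isStronglyCartesian (hF : IsDisplayMapClass F) (hq : q.IsFibered)
    {x y : Completion F q} {R S : B} (f : R ⟶ S) (a : x ⟶ y)
    (ha : (completionProj F q).IsStronglyCartesian f a) :
    ∃ (x' : Completion F q) (i : x ≅ x') (b : x' ⟶ y),
      (completionProj F q).IsHomLift (𝟙 R) i.hom ∧ (completionProj F q).IsHomLift f b ∧
        i.hom ≫ b = a ∧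
        IsPullback (q.map (Hom.hom b)) x'.disp y.disp (Hom.base b) ∧
        q.IsStronglyCartesian (q.map (Hom.hom b)) (Hom.hom b) := by
  obtain rfl : y.base = S := IsHomLift.codomain_eq (completionProj F q) f a
  obtain ⟨d, φ, g, hg, sq, hφ⟩ := exists_pullback hF hq y f
  let x' : Completion F q := ⟨d, R, g, hg⟩
  let b : x' ⟶ y := (⟨f, φ, sq.w⟩ : Completion.Hom x' y)
  have hb : (completionProj F q).IsStronglyCartesian f b := isStronglyCartesian b sq hφ
  obtain ⟨i, hi, hi'⟩ := exists_iso_of_cartesian (completionProj F q) f b a hb ha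
  exact ⟨x', i, b, hi, hb.toIsHomLift, hi', sq, hφ⟩

/-- The total component is forced to be `inv (Hom.hom a) ≫ Hom.hom b`, and the base component is
prescribed. -/
lemma existsUnique_of_isIso_hom {x y z : Completion F q} (a : x ⟶ y) [IsIso (Hom.hom a)]
    (g : y.base ⟶ z.base) (b : x ⟶ z) (hb : Hom.base a ≫ g = Hom.base b) :
    ∃! c : y ⟶ z, (completionProj F q).IsHomLift g c ∧ a ≫ c = b := by
  have w : q.map (inv (Hom.hom a) ≫ Hom.hom b) ≫ z.disp = y.disp ≫ g := by
    rw [← cancel_epi (q.map (Hom.hom a)), ← Category.assoc, ← q.map_comp,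
      IsIso.hom_inv_id_assoc, ← Category.assoc]
    exact (Hom.w b).trans (by rw [← hb, Hom.w a, Category.assoc])
  let c : y ⟶ z := (⟨g, inv (Hom.hom a) ≫ Hom.hom b, w⟩ : Completion.Hom y z)
  refine ⟨c, ⟨isHomLift_base c, hom_ext hb (IsIso.hom_inv_id_assoc _ _)⟩, ?_⟩
  rintro t ⟨ht, rfl⟩
  obtain rfl : g = Hom.base t := eq_base g t ht
  refine hom_ext rfl ?_
  rw [← cancel_epi (Hom.hom a)]
  exact (IsIso.hom_inv_id_assoc _ _).symm

/-- Arrows of the completion whose component in the total category is invertible are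
cocartesian. -/
lemma isStronglyCocartesian {x y : Completion F q} (a : x ⟶ y) (ha : IsIso (Hom.hom a)) :
    (completionProj F q).IsStronglyCocartesian (Hom.base a) a where
  universal_property' {z} g b hb :=
    existsUnique_of_isIso_hom a g b (eq_base (x := x) (y := z) _ b hb)

/-- The pushforward of `(g, α)` along a display map `u` is `(u ∘ g, α)`. -/
def pushforward (hcomp : HasDependentCoproducts F) (x : Completion F q) {J : B} (u : x.base ⟶ J)
    (hu : F u) : Completion F q :=
  ⟨x.obj, J, x.disp ≫ u, hcomp _ _ x.mem hu⟩

/-- The cocartesian arrow from an object to its pushforward. -/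
def toPushforward (hcomp : HasDependentCoproducts F) (x : Completion F q) {J : B} (u : x.base ⟶ J)
    (hu : F u) : x ⟶ pushforward hcomp x u hu :=
  (⟨u, 𝟙 _, (congrArg (· ≫ _) (q.map_id x.obj)).trans (Category.id_comp _)⟩ :
    Completion.Hom x (pushforward hcomp x u hu))

lemma toPushforward_isStronglyCocartesian (hcomp : HasDependentCoproducts F)
    (x : Completion F q) {J : B} (u : x.base ⟶ J) (hu : F u) :
    (completionProj F q).IsStronglyCocartesian u (toPushforward hcomp x u hu) :=
  isStronglyCocartesian (toPushforward hcomp x u hu) (inferInstanceAs (IsIso (𝟙 x.obj)))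

/-- Cocartesian arrows over display maps have invertible component in the total category. -/
lemma isIso_hom_of_isStronglyCocartesian (hcomp : HasDependentCoproducts F)
    {x y : Completion F q} {R S : B} (u : R ⟶ S) (hu : F u) (a : x ⟶ y)
    (ha : (completionProj F q).IsStronglyCocartesian u a) : IsIso (Hom.hom a) := by
  obtain rfl : x.base = R := IsHomLift.domain_eq (completionProj F q) u a
  obtain ⟨i, -, rfl⟩ := exists_iso_of_cocartesian (completionProj F q) u
    (toPushforward hcomp x u hu) a 
    (toPushforward_isStronglyCocartesian hcomp x u hu) ha
  have := isIso_hom i.hom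
  exact IsIso.comp_isIso' (inferInstanceAs (IsIso (𝟙 x.obj))) this

/-- The object `(𝟙, α)` of the completion. -/
def unitObj (hunits : HasUnits F) (d : D) : Completion F q :=
  (completionUnit F q hunits).obj d

/-- The cocartesian arrow `(𝟙, α) ⟶ (g, α)` over `g`. -/
def fromUnit (hunits : HasUnits F) (x : Completion F q) : unitObj hunits x.obj ⟶ x :=
  (⟨x.disp, 𝟙 x.obj, (congrArg (· ≫ _) (q.map_id x.obj)).trans
      ((Category.id_comp x.disp).trans (Category.id_comp x.disp).symm)⟩ :
    Completion.Hom (unitObj hunits x.obj) x)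

lemma fromUnit_isStronglyCocartesian (hunits : HasUnits F) (x : Completion F q) :
    (completionProj F q).IsStronglyCocartesian x.disp (fromUnit hunits x) :=
  isStronglyCocartesian (fromUnit hunits x) (inferInstanceAs (IsIso (𝟙 x.obj)))

/-- Since `Hom.hom κ` is invertible, the total component of a lift is forced. Its base component is
then forced by the commuting square, because `x.disp` is invertible. -/
lemma hasUniqueLifts_of_isIso_disp (hcomp : HasDependentCoproducts F) (x : Completion F q)
    [IsIso x.disp] : HasUniqueLifts (completionProj F q) F x := by
  intro R S u hu c d κ hκ h
  have := isIso_hom_of_isStronglyCocartesian hcomp u hu κ hκ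
  have w : q.map (Hom.hom h ≫ inv (Hom.hom κ)) ≫ c.disp =
      x.disp ≫ inv x.disp ≫ q.map (Hom.hom h ≫ inv (Hom.hom κ)) ≫ c.disp := by
    rw [IsIso.hom_inv_id_assoc]
  refine ⟨(⟨_, Hom.hom h ≫ inv (Hom.hom κ), w⟩ : Completion.Hom x c), hom_ext ?_ ?_, ?_⟩
  · change (inv x.disp ≫ q.map (Hom.hom h ≫ inv (Hom.hom κ)) ≫ c.disp) ≫ Hom.base κ = Hom.base h
    rw [← cancel_epi x.disp]
    simp only [Category.assoc, IsIso.hom_inv_id_assoc]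
    rw [← Hom.w κ, ← Category.assoc, ← q.map_comp, Category.assoc, IsIso.inv_hom_id,
      Category.comp_id]
    exact Hom.w h
  · exact (Category.assoc _ _ _).trans (by rw [IsIso.inv_hom_id, Category.comp_id])
  · rintro l rfl
    have h1 : Hom.hom l = Hom.hom (l ≫ κ) ≫ inv (Hom.hom κ) := by
      rw [comp_hom, Category.assoc, IsIso.hom_inv_id, Category.comp_id]
    refine hom_ext ?_ h1
    change Hom.base l = inv x.disp ≫ q.map (Hom.hom (l ≫ κ) ≫ inv (Hom.hom κ)) ≫ c.disp
    rw [← h1, IsIso.eq_inv_comp]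
    exact (Hom.w l).symm

/-- The objects `(𝟙, α)` have stable unique lifts. -/
lemma hasStableUniqueLifts_unitObj (hF : IsDisplayMapClass F) (hcomp : HasDependentCoproducts F)
    (hunits : HasUnits F) (hq : q.IsFibered) (d : D) :
    HasStableUniqueLifts (completionProj F q) F (unitObj hunits d) := by
  intro R S f x φ hφ
  -- The display map of `x'` is a pullback of an identity, hence invertible.
  obtain ⟨x', i, b, -, -, -, sq, -⟩ := exists_iso_of_isStronglyCartesian hF hq f φ hφ
  have h1 : IsIso (unitObj (F := F) (q := q) hunits d).disp := inferInstanceAs (IsIso (𝟙 (q.obj d)))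
  have h2 : IsIso x'.disp := MorphismProperty.of_isPullback (P := .isomorphisms B) sq h1
  exact (hasUniqueLifts_of_isIso_disp hcomp x').of_iso i.symm

end Completion

end CompletionArrows

/-! ### Extending functors along the unit of the completion -/

section Extension

variable {B : Type u₁} [Category.{v₁} B] {D : Type u₃} [Category.{v₃} D]
  {E : Type u₂} [Category.{v₂} E]
variable {F : MorphismProperty B} {q : D ⥤ B} {p : E ⥤ B} {K : D ⥤ E}
  {G G' : Completion F q ⥤ E}

/-- `G` sends `(g, α)` to the coproduct of `K α` along `g`, naturally. -/
structure Extension (p : E ⥤ B) (K : D ⥤ E) (G : Completion F q ⥤ E) where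
  /-- The cocartesian arrow `K α ⟶ G (g, α)`. -/
  arrow (x : Completion F q) : K.obj x.obj ⟶ G.obj x
  isStronglyCocartesian (x : Completion F q) : p.IsStronglyCocartesian x.disp (arrow x)
  naturality {x y : Completion F q} (a : x ⟶ y) :
    arrow x ≫ G.map a = K.map (Completion.Hom.hom a) ≫ arrow y

lemma obj_of_comp_eq (hK : K ⋙ p = q) (d : D) : p.obj (K.obj d) = q.obj d :=
  Functor.congr_obj hK d

/-! ### Existence of extensions, by choosing cocartesian arrows. -/

section Existence

variable [p.IsFibered] [HasCoproducts p F]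

/-- The chosen coproduct of `K α` along `g`. -/
def extendObj (hK : K ⋙ p = q) (x : Completion F q) : E :=
  (exists_isStronglyCocartesian p F x.disp x.mem (K.obj x.obj) (obj_of_comp_eq hK _)).choose

/-- The chosen cocartesian arrow out of `K α` over `g`. -/
def extendArrow (hK : K ⋙ p = q) (x : Completion F q) : K.obj x.obj ⟶ extendObj hK x :=
  (exists_isStronglyCocartesian p F x.disp x.mem (K.obj x.obj)
    (obj_of_comp_eq hK _)).choose_spec.choose

instance extendArrow_isStronglyCocartesian (hK : K ⋙ p = q) (x : Completion F q) :
    p.IsStronglyCocartesian x.disp (extendArrow hK x) :=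
  (exists_isStronglyCocartesian p F x.disp x.mem (K.obj x.obj)
    (obj_of_comp_eq hK _)).choose_spec.choose_spec

lemma extendObj_eq (hK : K ⋙ p = q) (x : Completion F q) : p.obj (extendObj hK x) = x.base :=
  have := extendArrow_isStronglyCocartesian hK x
  IsHomLift.codomain_eq p x.disp (extendArrow hK x)

/-- The commuting square of `a` is what places the right-hand composite over `x.disp ≫ Hom.base a`,
so that it factors through the cocartesian arrow. -/
lemma existsUnique_extendMap (hK : K ⋙ p = q) {x y : Completion F q} (a : x ⟶ y) :
    ∃! t : extendObj hK x ⟶ extendObj hK y, p.IsHomLift (Completion.Hom.base a) t ∧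
      extendArrow hK x ≫ t = K.map (Completion.Hom.hom a) ≫ extendArrow hK y := by
  have h := (isHomLift_map_iff hK _ _).2 (IsHomLift.map q (Completion.Hom.hom a))
  exact Functor.IsStronglyCocartesian.universal_property p x.disp (extendArrow hK x)
    (Completion.Hom.base a) _ (Completion.Hom.w a) (K.map (Completion.Hom.hom a) ≫ extendArrow hK y)

/-- The action on arrows of the extension of `K`. -/
def extendMap (hK : K ⋙ p = q) {x y : Completion F q} (a : x ⟶ y) :
    extendObj hK x ⟶ extendObj hK y :=
  (existsUnique_extendMap hK a).choose

instance extendMap_isHomLift (hK : K ⋙ p = q) {x y : Completion F q} (a : x ⟶ y) :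
    p.IsHomLift (Completion.Hom.base a) (extendMap hK a) :=
  (existsUnique_extendMap hK a).choose_spec.1.1

lemma extendArrow_extendMap (hK : K ⋙ p = q) {x y : Completion F q} (a : x ⟶ y) :
    extendArrow hK x ≫ extendMap hK a = K.map (Completion.Hom.hom a) ≫ extendArrow hK y :=
  (existsUnique_extendMap hK a).choose_spec.1.2

lemma extendMap_eq (hK : K ⋙ p = q) {x y : Completion F q} (a : x ⟶ y)
    (t : extendObj hK x ⟶ extendObj hK y) (h₁ : p.IsHomLift (Completion.Hom.base a) t)
    (h₂ : extendArrow hK x ≫ t = K.map (Completion.Hom.hom a) ≫ extendArrow hK y) :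
    extendMap hK a = t :=
  ((existsUnique_extendMap hK a).choose_spec.2 t ⟨h₁, h₂⟩).symm

/-- The extension of `K` to the completion. -/
def extend (hK : K ⋙ p = q) : Completion F q ⥤ E where
  obj := extendObj hK
  map := extendMap hK
  map_id x := extendMap_eq hK _ _ (IsHomLift.id (extendObj_eq hK x)) (by simp)
  map_comp {x y z} a b := extendMap_eq hK _ _
    (IsHomLift.comp p (Completion.Hom.base a) (Completion.Hom.base b) _ _) (by
      rw [← Category.assoc, extendArrow_extendMap, Category.assoc, extendArrow_extendMap,
        Completion.comp_hom, K.map_comp, Category.assoc])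

lemma extend_comp (hK : K ⋙ p = q) : extend hK ⋙ p = completionProj F q :=
  CategoryTheory.Functor.ext
    (extendObj_eq hK)
    fun _ _ a => IsHomLift.fac' p (Completion.Hom.base a) (extendMap hK a)

/-- The extension of `K` is an extension. -/
def extendExtension (hK : K ⋙ p = q) : Extension p K (extend (F := F) hK) where
  arrow := extendArrow hK
  isStronglyCocartesian := extendArrow_isStronglyCocartesian hK
  naturality := extendArrow_extendMap hK

end Existence

/-! ### Uniqueness, preservation properties and full faithfulness of extensions. -/

namespace Extension

lemma obj_eq (e : Extension p K G) (x : Completion F q) : p.obj (G.obj x) = x.base :=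
  have := e.isStronglyCocartesian x
  IsHomLift.codomain_eq p x.disp (e.arrow x)

lemma hom_ext (e : Extension p K G) {x : Completion F q} {c : E} {S : B} (f : x.base ⟶ S)
    {s t : G.obj x ⟶ c}
    (hs : p.IsHomLift f s) (ht : p.IsHomLift f t) (h : e.arrow x ≫ s = e.arrow x ≫ t) : s = t :=
  have := e.isStronglyCocartesian x
  Functor.IsStronglyCocartesian.ext p x.disp (e.arrow x) f h

lemma isHomLift_map (hG : G ⋙ p = completionProj F q) {x y : Completion F q} (a : x ⟶ y) :
    p.IsHomLift (Completion.Hom.base a) (G.map a) :=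
  (isHomLift_map_iff hG _ _).2 (Completion.isHomLift_base a)

/-- Two extensions of isomorphic functors are isomorphic. -/
lemma exists_iso (hG : G ⋙ p = completionProj F q) (hG' : G' ⋙ p = completionProj F q)
    (e : Extension p K G) (e' : Extension p K G') :
    ∃ i : G ≅ G', ∀ x : Completion F q, p.IsHomLift (𝟙 x.base) (i.hom.app x) := by
  choose i hi hi' using fun x : Completion F q =>
    exists_iso_of_cocartesian p x.disp (e.arrow x) (e'.arrow x) (e.isStronglyCocartesian x)
      (e'.isStronglyCocartesian x)
  refine ⟨NatIso.ofComponents i fun {x y} a => ?_, hi⟩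
  have h1 := isHomLift_map hG a
  have h2 := isHomLift_map hG' a
  have h3 := hi x
  have h4 := hi y
  refine e.hom_ext (Completion.Hom.base a) inferInstance inferInstance ?_
  rw [← Category.assoc, e.naturality, Category.assoc, hi', ← Category.assoc, hi', e'.naturality]

/-- At `(𝟙, α)` the structural arrow is cocartesian over an identity, hence invertible. -/
lemma exists_iso_unit (hunits : HasUnits F) (e : Extension p K G) :
    ∃ i : (completionUnit F q hunits).toFunctor ⋙ G ≅ K,
      ∀ d : D, p.IsHomLift (𝟙 (q.obj d)) (i.hom.app d) := by
  have h1 (d : D) : p.IsStronglyCocartesian (𝟙 (q.obj d))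
      (e.arrow (Completion.unitObj hunits d)) :=
    e.isStronglyCocartesian (Completion.unitObj hunits d)
  have h2 (d : D) : IsIso (e.arrow (Completion.unitObj hunits d)) :=
    have := h1 d
    Functor.IsStronglyCocartesian.isIso_of_base_isIso p (𝟙 (q.obj d)) _
  let j : K ≅ (completionUnit F q hunits).toFunctor ⋙ G :=
    NatIso.ofComponents (fun d => (@asIso _ _ _ _ (e.arrow (Completion.unitObj hunits d)) (h2 d) :
      K.obj d ≅ G.obj (Completion.unitObj hunits d))) fun {c d} φ =>
        (e.naturality ((completionUnit F q hunits).map φ)).symm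
  refine ⟨j.symm, fun d => ?_⟩
  have h3 : p.IsHomLift (𝟙 (q.obj d)) (j.app d).hom := (h1 d).toIsHomLift
  exact isHomLift_inv_id (j.app d) h3

/-- A functor preserving coproducts is an extension of its restriction along the unit. -/
lemma nonempty_of_iso_unit (hunits : HasUnits F)
    (hcop : ∀ {R S : B} (f : R ⟶ S), F f → ∀ {a b : Completion F q} (φ : a ⟶ b),
      (completionProj F q).IsStronglyCocartesian f φ → p.IsStronglyCocartesian f (G.map φ))
    (i : (completionUnit F q hunits).toFunctor ⋙ G ≅ K)
    (hi : ∀ d : D, p.IsHomLift (𝟙 (q.obj d)) (i.hom.app d)) :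
    Nonempty (Extension p K G) := by
  let t (d : D) : K.obj d ⟶ G.obj (Completion.unitObj hunits d) := i.inv.app d
  have ht (d : D) : IsIso (t d) :=
    ⟨(i.app d).hom, (i.app d).inv_hom_id, (i.app d).hom_inv_id⟩
  have htl (d : D) : p.IsHomLift (𝟙 (q.obj d)) (t d) := isHomLift_inv_id (i.app d) (hi d)
  -- The arrow `(𝟙, α) ⟶ (g, α)` is cocartesian over `g`, and `G` preserves this; `t` replaces its
  -- domain by `K α`.
  refine ⟨⟨fun x => t x.obj ≫ G.map (Completion.fromUnit hunits x), fun x => ?_, ?_⟩⟩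
  · exact isStronglyCocartesian_iso_comp p x.disp _ (htl _) _
      (hcop x.disp x.mem _ (Completion.fromUnit_isStronglyCocartesian hunits x))
  · intro x y a
    let u : Completion.unitObj (F := F) hunits x.obj ⟶ Completion.unitObj hunits y.obj :=
      (completionUnit F q hunits).map (Completion.Hom.hom a)
    have h1 : Completion.fromUnit hunits x ≫ a = u ≫ Completion.fromUnit hunits y :=
      Completion.hom_ext (Completion.Hom.w a).symm
        ((Category.id_comp _).trans (Category.comp_id _).symm)
    have h2 : K.map (Completion.Hom.hom a) ≫ t y.obj = t x.obj ≫ G.map u :=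
      i.inv.naturality (Completion.Hom.hom a)
    rw [Category.assoc, ← G.map_comp, h1, G.map_comp, ← Category.assoc, ← h2, Category.assoc]

/-- The total component of `a` is invertible, so naturality shows `e.arrow x ≫ G.map a` to be
cocartesian; cancelling the cocartesian `e.arrow x` leaves `G.map a`. -/
lemma preservesCoproducts (hG : G ⋙ p = completionProj F q) (hK : K ⋙ p = q)
    (e : Extension p K G) (hcomp : HasDependentCoproducts F) {R S : B} (f : R ⟶ S) (hf : F f)
    {x y : Completion F q} (a : x ⟶ y) (ha : (completionProj F q).IsStronglyCocartesian f a) :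
    p.IsStronglyCocartesian f (G.map a) := by
  obtain rfl : x.base = R := IsHomLift.domain_eq (completionProj F q) f a
  obtain rfl : y.base = S := IsHomLift.codomain_eq (completionProj F q) f a
  obtain rfl := Completion.eq_base f a ha.toIsHomLift
  have h1 := Completion.isIso_hom_of_isStronglyCocartesian hcomp _ hf a ha
  have h2 := e.isStronglyCocartesian x
  have h3 := e.isStronglyCocartesian y
  have h4 := isHomLift_map hG a
  have h5 : p.IsStronglyCocartesian (x.disp ≫ Completion.Hom.base a) (e.arrow x ≫ G.map a) := by
    rw [e.naturality, ← Completion.Hom.w a]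
    have := (isHomLift_map_iff hK _ _).2 (IsHomLift.map q (Completion.Hom.hom a))
    infer_instance
  exact Functor.IsStronglyCocartesian.of_comp p (f := x.disp) (φ := e.arrow x)

/-- For a pullback square with a cartesian arrow on top, `G.map b` is compared with a cartesian
lifting `φ` through a vertical `m`. Beck-Chevalley makes `e.arrow x' ≫ m` cocartesian; hence `m` is
cocartesian over an identity, so invertible. -/
lemma isFibred [p.IsFibered] [HasCoproducts p F] (hG : G ⋙ p = completionProj F q)
    (e : Extension p K G) (hF : IsDisplayMapClass F) (hq : q.IsFibered)
    (hK : ∀ {R S : B} (f : R ⟶ S) {a b : D} (φ : a ⟶ b),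
      q.IsStronglyCartesian f φ → p.IsStronglyCartesian f (K.map φ))
    {R S : B} (f : R ⟶ S) {x y : Completion F q} (a : x ⟶ y)
    (ha : (completionProj F q).IsStronglyCartesian f a) :
    p.IsStronglyCartesian f (G.map a) := by
  obtain ⟨x', i, b, hi, hb, rfl, sq, hc⟩ :=
    Completion.exists_iso_of_isStronglyCartesian hF hq f a ha
  rw [G.map_comp]
  refine isStronglyCartesian_iso_comp p f _ ((isHomLift_map_iff hG _ _).2 hi) _ ?_
  obtain rfl : x'.base = R := IsHomLift.domain_eq (completionProj F q) f b
  obtain rfl : y.base = S := IsHomLift.codomain_eq (completionProj F q) f b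
  obtain rfl := Completion.eq_base f b hb
  obtain ⟨c, φ, hφ⟩ := exists_isStronglyCartesian p (Completion.Hom.base b) (G.obj y) (e.obj_eq y)
  have h1 := isHomLift_map hG b
  obtain ⟨m, ⟨hm, hm'⟩, -⟩ :=
    Functor.IsCartesian.universal_property (p := p) (f := Completion.Hom.base b) (φ := φ) (G.map b)
  have h2 := e.isStronglyCocartesian x'
  have h3 : p.IsStronglyCocartesian x'.disp (e.arrow x' ≫ m) :=
    isStronglyCocartesian_of_isPullback p sq.flip x'.mem y.mem (e.arrow y)
      (e.isStronglyCocartesian y) _ (hK _ _ hc) φ hφ _ inferInstance (by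
        rw [Category.assoc, hm', e.naturality])
  have h4 : p.IsStronglyCocartesian (x'.disp ≫ 𝟙 x'.base) (e.arrow x' ≫ m) := by
    rwa [Category.comp_id]
  have h5 : p.IsStronglyCocartesian (𝟙 x'.base) m :=
    Functor.IsStronglyCocartesian.of_comp p (f := x'.disp) (φ := e.arrow x')
  have h6 : IsIso m := Functor.IsStronglyCocartesian.isIso_of_base_isIso p (𝟙 x'.base) m
  rw [← hm']
  exact isStronglyCartesian_iso_comp p _ m hm φ hφ

/-- If the values of a fully faithful `K` have unique lifts then its extension is fully faithful. -/
lemma existsUnique_map_eq (hG : G ⋙ p = completionProj F q) (hK : K ⋙ p = q) [K.Full]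
    [K.Faithful] (e : Extension p K G) (hlift : ∀ d : D, HasUniqueLifts p F (K.obj d))
    {x y : Completion F q} (h : G.obj x ⟶ G.obj y) : ∃! a : x ⟶ y, G.map a = h := by
  -- By naturality, the total component of any preimage of `h` must solve this lifting problem.
  obtain ⟨k, hk, huniq⟩ := hlift x.obj y.disp y.mem (e.arrow y) (e.isStronglyCocartesian y)
    (e.arrow x ≫ h)
  obtain ⟨φ, rfl⟩ := K.map_surjective k
  obtain ⟨f, hf⟩ := exists_isHomLift p h (e.obj_eq x) (e.obj_eq y)
  have h1 := e.isStronglyCocartesian x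
  have h2 := e.isStronglyCocartesian y
  have h3 := (isHomLift_map_iff hK _ _).2 (IsHomLift.map q φ)
  -- The square commutes because both composites underlie the same arrow of `E`.
  have w : q.map φ ≫ y.disp = x.disp ≫ f := by
    have h4 : p.IsHomLift (q.map φ ≫ y.disp) (K.map φ ≫ e.arrow y) := inferInstance
    rw [hk] at h4
    exact isHomLift_unique p _ h4 inferInstance
  let a : x ⟶ y := (⟨f, φ, w⟩ : Completion.Hom x y)
  have ha : p.IsHomLift f (G.map a) := isHomLift_map hG a
  refine ⟨a, e.hom_ext f ha hf ((e.naturality a).trans hk), ?_⟩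
  rintro b rfl
  have hb := isHomLift_map hG b
  exact Completion.hom_ext (isHomLift_unique p _ hb hf)
    (K.map_injective (huniq _ (e.naturality b).symm))

lemma isVerticalEquivalence (hG : G ⋙ p = completionProj F q) (hK : K ⋙ p = q) [K.Full]
    [K.Faithful] (e : Extension p K G) (hlift : ∀ d : D, HasUniqueLifts p F (K.obj d))
    (henough : ∀ a : E, ∃ (d : D) (f : q.obj d ⟶ p.obj a) (κ : K.obj d ⟶ a),
      F f ∧ p.IsStronglyCocartesian f κ) : IsVerticalEquivalence p G where
  full := ⟨fun h => (e.existsUnique_map_eq hG hK hlift h).exists⟩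
  faithful := ⟨fun {x y} a b h => (e.existsUnique_map_eq hG hK hlift (G.map b)).unique h rfl⟩
  exists_iso a := by
    obtain ⟨d, f, κ, hf, hκ⟩ := henough a
    let x : Completion F q := ⟨d, p.obj a, f, hf⟩
    obtain ⟨i, hi, -⟩ := exists_iso_of_cocartesian p f (e.arrow x) κ
      (e.isStronglyCocartesian x) hκ
    exact ⟨x, i, hi⟩

end Extension

/-- A fibration equivalent to a completion has enough quantifier-free objects. -/
lemma IsVerticalEquivalence.enoughQuantifierFree [p.IsFibered] [HasCoproducts p F]
    (h : IsVerticalEquivalence p G) (hG : G ⋙ p = completionProj F q)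
    (hF : IsDisplayMapClass F) (hunits : HasUnits F) (hcomp : HasDependentCoproducts F)
    (hq : q.IsFibered) : EnoughQuantifierFree p F := by
  rw [enoughQuantifierFree_iff p hF]
  intro a
  obtain ⟨x, i, hi⟩ := h.exists_iso a
  obtain hx : x.base = p.obj a := by
    rw [← IsHomLift.domain_eq p (𝟙 (p.obj a)) i.hom]
    exact (Functor.congr_obj hG x).symm
  obtain ⟨d, I, g, hg⟩ := x
  obtain rfl : I = p.obj a := hx
  let x : Completion F q := ⟨d, p.obj a, g, hg⟩
  -- If `a` is the image of `(g, α)`, then it is the coproduct along `g` of the image of `(𝟙, α)`.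
  refine ⟨q.obj d, g, G.obj (Completion.unitObj hunits d),
    G.map (Completion.fromUnit hunits x) ≫ i.hom, hg, ?_, ?_⟩
  · exact h.hasStableUniqueLifts_map hG
      (Completion.hasStableUniqueLifts_unitObj hF hcomp hunits hq d)
  · exact isStronglyCocartesian_comp_iso p g _ (h.isStronglyCocartesian_map hG g _
      (Completion.fromUnit_isStronglyCocartesian hunits x)) i.hom hi

lemma IsFibredEquivalence.enoughQuantifierFree [p.IsFibered] [HasCoproducts p F]
    {G : BasedCategory.ofFunctor (completionProj F q) ⥤ᵇ BasedCategory.ofFunctor p}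
    (h : IsFibredEquivalence G) (hF : IsDisplayMapClass F) (hunits : HasUnits F)
    (hcomp : HasDependentCoproducts F) (hq : q.IsFibered) : EnoughQuantifierFree p F :=
  IsVerticalEquivalence.enoughQuantifierFree (p := p) h.isVerticalEquivalence G.w hF hunits hcomp hq

end Extension

/-! ### The comparison functor -/

section Comparison

variable {B : Type u₁} [Category.{v₁} B] {E : Type u₂} [Category.{v₂} E]
variable {F : MorphismProperty B} (p : E ⥤ B) [p.IsFibered] [HasCoproducts p F]

instance : (quantifierFree p F).ι.Full := ObjectProperty.full_ι _

instance : (quantifierFree p F).ι.Faithful := ObjectProperty.faithful_ι _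

lemma isComparison_of_extension (hF : IsDisplayMapClass F) (hunits : HasUnits F)
    (hcomp : HasDependentCoproducts F) {G : Completion F (qfProj p F) ⥤ E}
    (hG : G ⋙ p = completionProj F (qfProj p F))
    (e : Extension p (quantifierFree p F).ι G) : IsComparison p F hunits ⟨G, hG⟩ where
  fibred f _ _ φ hφ := e.isFibred hG hF (qfProj_isFibered p hF)
    (fun f _ _ φ hφ => isStronglyCartesian_of_qfProj p hF f φ hφ) f φ hφ
  preservesCoproducts f hf _ _ φ hφ := e.preservesCoproducts hG rfl hcomp f hf φ hφ
  unit := by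
    obtain ⟨i, hi⟩ := e.exists_iso_unit hunits
    exact ⟨BasedNatIso.mkNatIso i hi⟩

variable {p} in
-- Every comparison is thus determined by universal arrows, so uniqueness and the equivalence
-- criterion hold for all comparisons and not only the constructed one.
lemma IsComparison.nonempty_extension {hunits : HasUnits F}
    {G : BasedCategory.ofFunctor (completionProj F (qfProj p F)) ⥤ᵇ BasedCategory.ofFunctor p}
    (h : IsComparison p F hunits G) :
    Nonempty (Extension p (quantifierFree p F).ι G.toFunctor) := by
  obtain ⟨i⟩ := h.unit
  exact Extension.nonempty_of_iso_unit hunits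
    (fun f hf _ _ φ hφ => h.preservesCoproducts f hf φ hφ)
    ((BasedNatTrans.forgetful _ _).mapIso i) i.hom.isHomLift'

/-- The comparison is an equivalence if there are enough quantifier-free objects. -/
lemma isVerticalEquivalence_of_enoughQuantifierFree (hF : IsDisplayMapClass F)
    (henough : EnoughQuantifierFree p F) {G : Completion F (qfProj p F) ⥤ E}
    (hG : G ⋙ p = completionProj F (qfProj p F))
    (e : Extension p (quantifierFree p F).ι G) : IsVerticalEquivalence p G := by
  refine e.isVerticalEquivalence hG rfl
    (fun d => ((quantifierFree_iff p hF _).1 d.property).hasUniqueLifts) fun a => ?_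
  obtain ⟨A, f, b, κ, hf, hb, hκ⟩ := (enoughQuantifierFree_iff p hF).1 henough a
  obtain rfl := IsHomLift.domain_eq p f κ
  exact ⟨⟨b, (quantifierFree_iff p hF b).2 hb⟩, f, κ, hf, hκ⟩

end Comparison

end FibCoprod

end

theorem mainTheorem2 {B : Type u₁} [Category.{v₁} B] (F : MorphismProperty B)
    (hF : FibCoprod.IsDisplayMapClass F) (hunits : FibCoprod.HasUnits F)
    (hcomp : FibCoprod.HasDependentCoproducts F)
    {E : Type u₂} [Category.{v₂} E] (p : E ⥤ B) [p.IsFibered] [FibCoprod.HasCoproducts p F] :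
    -- `p` is an instance of the completion iff it has enough quantifier-free objects
    ((∃ (D : Type u₂) (_ : Category.{v₂} D) (q : D ⥤ B), q.IsFibered ∧
        FibCoprod.FibredEquivalent (FibCoprod.completionProj F q) p) ↔
      FibCoprod.EnoughQuantifierFree p F) ∧
    -- the forward direction holds for fibrations `q` of any size
    (∀ (D : Type u₃) [Category.{v₃} D] (q : D ⥤ B), q.IsFibered →
      FibCoprod.FibredEquivalent (FibCoprod.completionProj F q) p →
      FibCoprod.EnoughQuantifierFree p F) ∧
    -- the quantifier-free objects form a subfibration
    ((FibCoprod.qfProj p F).IsFibered ∧ FibCoprod.IsFibredFunctor (FibCoprod.qfIncl p F)) ∧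
    -- the comparison exists, is unique up to vertical isomorphism, and is an equivalence exactly
    -- when there are enough quantifier-free objects
    (∃ G, FibCoprod.IsComparison p F hunits G) ∧
    (∀ G G', FibCoprod.IsComparison p F hunits G → FibCoprod.IsComparison p F hunits G' →
      Nonempty (G ≅ G')) ∧
    (∀ G, FibCoprod.IsComparison p F hunits G →
      (FibCoprod.IsFibredEquivalence G ↔ FibCoprod.EnoughQuantifierFree p F)) := by
  have hfib := FibCoprod.qfProj_isFibered p hF
  have hext := FibCoprod.extendExtension (F := F) (p := p) (q := FibCoprod.qfProj p F)
    (K := (FibCoprod.quantifierFree p F).ι) rfl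
  have hextc := FibCoprod.extend_comp (F := F) (p := p) (q := FibCoprod.qfProj p F)
    (K := (FibCoprod.quantifierFree p F).ι) rfl
  refine ⟨⟨?_, fun h => ?_⟩, ?_, ⟨hfib, FibCoprod.qfIncl_isFibredFunctor p hF⟩, ?_, ?_, ?_⟩
  · rintro ⟨D, _, q, hq, G, hG⟩
    exact hG.enoughQuantifierFree hF hunits hcomp hq
  -- The witness is the subfibration of quantifier-free objects, a full subcategory of `E` and so in
  -- the same universes.
  · exact ⟨_, _, FibCoprod.qfProj p F, hfib, _,
      (FibCoprod.isVerticalEquivalence_of_enoughQuantifierFree p hF h hextc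
        hext).isFibredEquivalence hextc⟩
  · rintro D _ q hq ⟨G, hG⟩
    exact hG.enoughQuantifierFree hF hunits hcomp hq
  · exact ⟨_, FibCoprod.isComparison_of_extension p hF hunits hcomp hextc hext⟩
  · intro G G' hG hG'
    obtain ⟨e⟩ := hG.nonempty_extension
    obtain ⟨e'⟩ := hG'.nonempty_extension
    obtain ⟨i, hi⟩ := FibCoprod.Extension.exists_iso G.w G'.w e e'
    exact ⟨BasedNatIso.mkNatIso i hi⟩
  · intro G hG
    obtain ⟨e⟩ := hG.nonempty_extension
    refine ⟨fun h => h.enoughQuantifierFree hF hunits hcomp hfib,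
      fun h => ?_⟩
    exact (FibCoprod.isVerticalEquivalence_of_enoughQuantifierFree p hF h G.w
      e).isFibredEquivalence G.w
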